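/- Let $f,g$ be vector fields/maps with values in $\mathbb R^n$, let $c(x)=z^{\top}x-b$ with $z\in\mathbb R^n\setminus\{0\}$, $b\in\mathbb R$, and let $S=\{x: c(x)=0\}$ be the switching surface. Consider the hybrid system $$\dot x=f(x)\quad (x\notin S),\qquad x^+=g(x)\quad (x\in S),$$ whose solutions are written right-continuously: at an impulse time $t$ the left limit $x(t^-)$ lies on $S$ and $x(t)=g(x(t^-))$; at all other times $x$ is continuous; $x(t)\notin S$ for all $t\ge 0$; and an initial state $x_0\in S$ undergoes its impulse at time $0$, that is, $x(0)=g(x_0)$. Let $K\subset\mathbb R^n$ be compact with $c\le 0$ on $K$ and $K\setminus S$ connected and non-empty (a single continuous phase). Assume that $f$ is smooth near each point of $K$ and $g$ near each point of $K\cap S$, and that * $K$ is strictly forward invariant: from each initial state in $K$ a solution exists on $[0,\infty)$, and every such solution is in the interior of $K$ for all $t>0$; * $f(x)\neq0$ for all $x\in K$; every solution starting in $K$ arrives at $S$ after a finite positive time; and $f(x)^{\top}z\ne0$ for all $x\in K\cap S$. Suppose there are a $C^1$ Riemannian metric $M(x)$ (symmetric positive definite for $x\in K$) and a rate $\lambda>0$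 such that, with $V(x,\delta)=\sqrt{\delta^{\top}M(x)\delta}$, 1. (transverse contraction) for all $x\in K$ and all $\delta\neq0$ with $\frac{\partial V}{\partial\delta}(x,\delta)f(x)=0$, $$\frac{\partial V(x,\delta)}{\partial x}f(x)+\frac{\partial V(x,\delta)}{\partial\delta}\frac{\partial f(x)}{\partial x}\delta\le-\lambda V(x,\delta);$$ 2. (orthogonality) $f(x)^{\top}M(x)\delta=0$ for all $x\in K\cap S$ and all $\delta$ tangent to $S$, that is, with $z^{\top}\delta=0$; 3. (impulse) for all $x\in K\cap S$ and all $\delta$ with $\delta^{\top}M(x)f(x)=0$, $$\delta^{\top}\Big(\tfrac{\partial g}{\partial x}(x)^{\top}M(g(x))\tfrac{\partial g}{\partial x}(x)-M(x)\Big)\delta\le0.$$ Then there is exactly one limit cycle in $K$, that is, exactly one set $\mathcal X^\star\subseteq K$ of the form $\{x^\star(t):0\le t<T\}$ with $x^\star$ a non-constant $T$-periodic solution, $T>0$. It is orbitally stable: there is $r>0$ such that from every initial state $x_0$ with $c(x_0)\le0$ and $\operatorname{dist}(x_0,\mathcal X^\star)<r$ there is a unique solution $x$ on $[0,\infty)$,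 and $\operatorname{dist}(x(t),\mathcal X^\star)\to0$ as $t\to\infty$. -/

import Mathlib

open Set Filter Topology
open scoped ContDiff

/-- The flat switching surface `S = {x | c x = 0}` with `c x = ⟪z, x⟫ - b`; its normal is `z`
and its tangent space at each point is `{δ | ⟪z, δ⟫ = 0}`. -/
def switchingSurface {n : ℕ} (z : EuclideanSpace ℝ (Fin n)) (b : ℝ) :
    Set (EuclideanSpace ℝ (Fin n)) :=
  {x | inner ℝ z x - b = 0}

/-- `w` is the state that follows `y`: it is `g y` if `y` lies on the switching surface, and `y`
itself otherwise. -/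
def IsPostState {n : ℕ} (g : EuclideanSpace ℝ (Fin n) → EuclideanSpace ℝ (Fin n))
    (S : Set (EuclideanSpace ℝ (Fin n))) (y w : EuclideanSpace ℝ (Fin n)) : Prop :=
  (y ∈ S → w = g y) ∧ (y ∉ S → w = y)

/-- `x`, considered on `[0, ∞)`, is a solution of the hybrid system `x' = f x` off `S`,
`x⁺ = g x` on `S`. Solutions are written right-continuously: at an impulse time `t` the state
before the impulse is the left limit of `x` at `t`, it lies on `S`, and `x t` is the state after the
impulse. At every other time `x` is continuous. Since `x t` is never on a closed set `S`, impulse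
times cannot accumulate. -/
structure IsHybridSolution {n : ℕ} (f g : EuclideanSpace ℝ (Fin n) → EuclideanSpace ℝ (Fin n))
    (S : Set (EuclideanSpace ℝ (Fin n))) (x : ℝ → EuclideanSpace ℝ (Fin n)) : Prop where
  notMem : ∀ t : ℝ, 0 ≤ t → x t ∉ S
  flow : ∀ t : ℝ, 0 ≤ t → HasDerivWithinAt x (f (x t)) (Ici t) t
  impulse : ∀ t : ℝ, 0 < t →
    ∃ y : EuclideanSpace ℝ (Fin n), Tendsto x (𝓝[<] t) (𝓝 y) ∧ IsPostState g S y (x t)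

/-- `x` is a solution of the hybrid system with initial state `x₀` (if `x₀` is on `S`, the impulse
takes place at time `0`). -/
def IsHybridSolutionFrom {n : ℕ} (f g : EuclideanSpace ℝ (Fin n) → EuclideanSpace ℝ (Fin n))
    (S : Set (EuclideanSpace ℝ (Fin n))) (x₀ : EuclideanSpace ℝ (Fin n))
    (x : ℝ → EuclideanSpace ℝ (Fin n)) : Prop :=
  IsHybridSolution f g S x ∧ IsPostState g S x₀ (x 0)

/-- Solutions that start in `K` exist for all time, and they are in the interior of `K` for all
positive times. -/
def StrictlyForwardInvariant {n : ℕ}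
    (f g : EuclideanSpace ℝ (Fin n) → EuclideanSpace ℝ (Fin n))
    (S K : Set (EuclideanSpace ℝ (Fin n))) : Prop :=
  ∀ x₀ ∈ K, (∃ x, IsHybridSolutionFrom f g S x₀ x) ∧
    ∀ x, IsHybridSolutionFrom f g S x₀ x → ∀ t : ℝ, 0 < t → x t ∈ interior K

/-- Every solution that starts in `K` arrives at the switching surface after a finite positive
time. -/
def ReachesSurface {n : ℕ} (f g : EuclideanSpace ℝ (Fin n) → EuclideanSpace ℝ (Fin n))
    (S K : Set (EuclideanSpace ℝ (Fin n))) : Prop :=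
  ∀ x₀ ∈ K, ∀ x, IsHybridSolutionFrom f g S x₀ x →
    ∃ t : ℝ, 0 < t ∧ ∃ y ∈ S, Tendsto x (𝓝[<] t) (𝓝 y)

/-- `M` is a Riemannian metric of class `C¹` on `K`. -/
structure IsRiemannianMetricOn {n : ℕ}
    (M : EuclideanSpace ℝ (Fin n) → EuclideanSpace ℝ (Fin n) →L[ℝ] EuclideanSpace ℝ (Fin n))
    (K : Set (EuclideanSpace ℝ (Fin n))) : Prop where
  contDiffAt : ∀ x ∈ K, ContDiffAt ℝ 1 M x
  symmetric : ∀ x ∈ K, ∀ u v, inner ℝ (M x u) v = inner ℝ u (M x v)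
  posDef : ∀ x ∈ K, ∀ u, u ≠ 0 → 0 < inner ℝ u (M x u)

/-- `V(x, δ) = √(δᵀ M(x) δ)`. -/
noncomputable def metricNorm {n : ℕ}
    (M : EuclideanSpace ℝ (Fin n) → EuclideanSpace ℝ (Fin n) →L[ℝ] EuclideanSpace ℝ (Fin n))
    (x δ : EuclideanSpace ℝ (Fin n)) : ℝ :=
  Real.sqrt (inner ℝ δ (M x δ))

/-- The vector field `f` is transverse contracting on `K` with rate `lam` in the metric `M`:
`(∂V/∂x) f + (∂V/∂δ) (∂f/∂x) δ ≤ - lam V` for all `δ ≠ 0` with `(∂V/∂δ) f = 0`. -/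
def TransverseContracting {n : ℕ}
    (f : EuclideanSpace ℝ (Fin n) → EuclideanSpace ℝ (Fin n))
    (M : EuclideanSpace ℝ (Fin n) → EuclideanSpace ℝ (Fin n) →L[ℝ] EuclideanSpace ℝ (Fin n))
    (lam : ℝ) (K : Set (EuclideanSpace ℝ (Fin n))) : Prop :=
  ∀ x ∈ K, ∀ δ : EuclideanSpace ℝ (Fin n), δ ≠ 0 →
    fderiv ℝ (fun d => metricNorm M x d) δ (f x) = 0 →
    fderiv ℝ (fun y => metricNorm M y δ) x (f x) +
        fderiv ℝ (fun d => metricNorm M x d) δ (fderiv ℝ f x δ) ≤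
      -lam * metricNorm M x δ

/-- `X` is the orbit `{x t | 0 ≤ t < T}` of a non-constant `T`-periodic solution `x`. -/
def IsLimitCycle {n : ℕ} (f g : EuclideanSpace ℝ (Fin n) → EuclideanSpace ℝ (Fin n))
    (S X : Set (EuclideanSpace ℝ (Fin n))) : Prop :=
  ∃ (x : ℝ → EuclideanSpace ℝ (Fin n)) (T : ℝ), 0 < T ∧ IsHybridSolution f g S x ∧
    (∀ t : ℝ, 0 ≤ t → x (t + T) = x t) ∧ (∃ t : ℝ, 0 ≤ t ∧ x t ≠ x 0) ∧ X = x '' Ico 0 T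

/-- Orbital stability of the orbit `X` among the initial states in `D`: from every initial state
in `D` at distance less than some `r > 0` from `X` there is a unique solution, and its distance
from `X` tends to zero. -/
def OrbitallyStable {n : ℕ} (f g : EuclideanSpace ℝ (Fin n) → EuclideanSpace ℝ (Fin n))
    (S D X : Set (EuclideanSpace ℝ (Fin n))) : Prop :=
  ∃ r : ℝ, 0 < r ∧ ∀ x₀ ∈ D, Metric.infDist x₀ X < r →
    ∃ x, IsHybridSolutionFrom f g S x₀ x ∧
      (∀ y, IsHybridSolutionFrom f g S x₀ y → EqOn y x (Ici 0)) ∧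
      Tendsto (fun t => Metric.infDist (x t) X) atTop (𝓝 0)

/-! ### Uniform estimates on compact sets -/

/-! Everything happens on the return map `P y = hit (g y)` of `K ∩ S`: jump, then fly to the next
arrival at `S`. Two nearby points of `S` differ by a tangent vector, which by orthogonality has no
component along `f`. The jump therefore does not expand its `M`-length to first order. During the
flight the part of the displacement orthogonal to `f` shrinks like `exp (-lam * t)`
(`transverseSq_trajectories_le`). The part along `f` is only a time lag, and it disappears when the
second flight is followed up to `S` (`metricSq_hit_le`). Since flights after an impulse last at
least some `Tmin > 0`, `P` contracts nearby points of `K ∩ S` in the length given by `M`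
(`exists_return_le`). The estimates use finite differences with remainders uniform on compact sets,
so the flow and arrival time are never differentiated in the initial state.

The set `K ∩ S` need not be connected, so a local contraction alone gives neither existence nor
uniqueness of a fixed point. But `hit` is continuous on the connected set `K \ S`, because crossings
are transversal, and `P (hit x) = hit (g (hit x))`. Hence all `P`-orbits of points `hit x` merge
geometrically. In particular each merges with its own shift, so they converge to one fixed point `p`
(`exists_fixedPoint_of_locally_contracting`).

The flight from `g p` closes up to a periodic orbit that attracts every solution starting in `K`,
and a periodic solution attracted by it must coincide with it up to a time shift. For stability, `p`
is on `S` and hence not interior to `K`; states near `p` with `c ≤ 0` may lie outside `K`, but a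
short flight and an impulse bring them into the interior (`exists_local_arc`). -/

theorem IsCompact.exists_uniform_of_eventually {X : Type*} [PseudoMetricSpace X] {K : Set X}
    (hK : IsCompact K) {p : X → X → Prop}
    (h : ∀ x ∈ K, ∀ᶠ q : X × X in 𝓝 (x, x), p q.1 q.2) :
    ∃ r > 0, ∀ x ∈ K, ∀ y, dist y x < r → p x y := by
  refine hK.induction_on (p := fun s => ∃ r > 0, ∀ x ∈ s, ∀ y, dist y x < r → p x y)
    ⟨1, one_pos, fun x hx => absurd hx (notMem_empty x)⟩ ?_ ?_ ?_
  · rintro s t hst ⟨r, hr, h⟩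
    exact ⟨r, hr, fun x hx => h x (hst hx)⟩
  · rintro s t ⟨r, hr, h⟩ ⟨r', hr', h'⟩
    refine ⟨min r r', lt_min hr hr', ?_⟩
    rintro x (hx | hx) y hy
    · exact h x hx y (hy.trans_le (min_le_left _ _))
    · exact h' x hx y (hy.trans_le (min_le_right _ _))
  · intro x hx
    obtain ⟨ρ, hρ, hp⟩ := Metric.eventually_nhds_iff.1 (h x hx)
    refine ⟨Metric.ball x (ρ / 2), mem_nhdsWithin_of_mem_nhds (Metric.ball_mem_nhds x (by linarith)),
      ρ / 2, by linarith, fun y hy w hw => ?_⟩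
    refine @hp (y, w) ?_
    rw [Metric.mem_ball] at hy
    have := dist_triangle w y x
    rw [Prod.dist_eq]
    exact max_lt (by linarith) (by simp only; linarith)

theorem IsCompact.exists_norm_le_of_continuousOn {E F : Type*} [TopologicalSpace E] [SeminormedAddCommGroup F]
    {K : Set E} (hK : IsCompact K) {f : E → F}
    (hf : ContinuousOn f K) : ∃ B > 0, ∀ x ∈ K, ‖f x‖ ≤ B := by
  obtain ⟨B, hB⟩ := hK.exists_bound_of_continuousOn hf
  exact ⟨max B 1, by positivity, fun x hx => (hB x hx).trans (le_max_left _ _)⟩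

section

variable {E F : Type*} [NormedAddCommGroup E] [NormedSpace ℝ E] [NormedAddCommGroup F]
  [NormedSpace ℝ F]

/-- Strict differentiability controls pairs of points near the diagonal, and continuity of the
derivative moves its base point to the first of them. No segment has to lie in `K`, so convexity is
not needed. -/
theorem IsCompact.exists_uniform_fderiv {K : Set E} (hK : IsCompact K) {f : E → F}
    (hf : ∀ x ∈ K, ContDiffAt ℝ 1 f x) {ε : ℝ} (hε : 0 < ε) :
    ∃ r > 0, ∀ x ∈ K, ∀ y, dist y x < r →
      ‖f y - f x - fderiv ℝ f x (y - x)‖ ≤ ε * ‖y - x‖ := by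
  refine hK.exists_uniform_of_eventually fun x hx => ?_
  have h1 : ∀ᶠ q : E × E in 𝓝 (x, x),
      ‖f q.2 - f q.1 - fderiv ℝ f x (q.2 - q.1)‖ ≤ ε / 2 * ‖q.2 - q.1‖ := by
    have h := ((hf x hx).hasStrictFDerivAt one_ne_zero).isLittleO.def (half_pos hε)
    exact (continuous_swap.tendsto (x, x)).eventually h
  have h2 : ∀ᶠ q : E × E in 𝓝 (x, x), ‖fderiv ℝ f q.1 - fderiv ℝ f x‖ < ε / 2 := by
    have h : ContinuousAt (fderiv ℝ f) x :=
      ((hf x hx).fderiv_right (m := 0) (by norm_num)).continuousAt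
    have h' := (h.comp (f := Prod.fst) (x := (x, x)) continuousAt_fst).tendsto
    have := h'.eventually (Metric.ball_mem_nhds _ (half_pos hε))
    simpa [dist_eq_norm] using this
  filter_upwards [h1, h2] with q h1 h2
  have h3 : ‖(fderiv ℝ f q.1 - fderiv ℝ f x) (q.2 - q.1)‖ ≤ ε / 2 * ‖q.2 - q.1‖ :=
    (ContinuousLinearMap.le_opNorm _ _).trans (by gcongr)
  have h4 : f q.2 - f q.1 - fderiv ℝ f q.1 (q.2 - q.1) =
      (f q.2 - f q.1 - fderiv ℝ f x (q.2 - q.1)) -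
        (fderiv ℝ f q.1 - fderiv ℝ f x) (q.2 - q.1) := by
    simp only [sub_apply]; abel
  rw [h4]
  refine (norm_sub_le _ _).trans ?_
  linarith

theorem IsCompact.exists_lipschitzOnWith_of_contDiffAt {K : Set E} (hK : IsCompact K) {f : E → F}
    (hf : ∀ x ∈ K, ContDiffAt ℝ 1 f x) : ∃ L, LipschitzOnWith L f K := by
  refine LocallyLipschitzOn.exists_lipschitzOnWith_of_compact hK fun x hx => ?_
  obtain ⟨L, t, ht, h⟩ := (hf x hx).exists_lipschitzOnWith
  exact ⟨L, t, mem_nhdsWithin_of_mem_nhds ht, h⟩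

theorem continuousOn_of_contDiffAt {K : Set E} {f : E → F} (hf : ∀ x ∈ K, ContDiffAt ℝ 1 f x) :
    ContinuousOn f K := fun x hx => (hf x hx).continuousAt.continuousWithinAt

/-- Mean value inequality from right derivatives alone, the only derivatives that hybrid solutions
provide. -/
theorem le_of_hasDerivWithinAt_Ici_ge {φ φ' : ℝ → ℝ} {m a b : ℝ} (hab : a ≤ b)
    (hφ : ContinuousOn φ (Icc a b)) (hφ' : ∀ t ∈ Ico a b, HasDerivWithinAt φ (φ' t) (Ici t) t)
    (hm : ∀ t ∈ Ico a b, m ≤ φ' t) : φ a + m * (b - a) ≤ φ b := by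
  have h := image_le_of_deriv_right_le_deriv_boundary (f := fun t => φ a + m * (t - a))
    (f' := fun _ => m) (B := φ) (B' := φ') (a := a) (b := b) (by fun_prop)
    (fun t _ => by
      simpa using ((((hasDerivAt_id t).sub_const a).const_mul m).const_add (φ a)).hasDerivWithinAt)
    (by simp) hφ hφ' hm
  exact h (right_mem_Icc.2 hab)

end

/-! ### Quadratic form of the metric -/

section

variable {E : Type*} [NormedAddCommGroup E] [InnerProductSpace ℝ E]

/-- The squared length `δᵀ M(x) δ`. -/
noncomputable def metricSq (M : E → E →L[ℝ] E) (x δ : E) : ℝ := inner ℝ δ (M x δ)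

theorem metricSq_add {M : E → E →L[ℝ] E} {x : E}
    (hs : ∀ u v, inner ℝ (M x u) v = inner ℝ u (M x v)) (u v : E) :
    metricSq M x (u + v) = metricSq M x u + 2 * inner ℝ u (M x v) + metricSq M x v := by
  simp only [metricSq, map_add, inner_add_left, inner_add_right]
  rw [← hs v u, real_inner_comm u (M x v)]; ring

theorem metricSq_smul (M : E → E →L[ℝ] E) (x : E) (c : ℝ) (u : E) :
    metricSq M x (c • u) = c ^ 2 * metricSq M x u := by
  simp only [metricSq, map_smul, inner_smul_left, inner_smul_right]
  simp; ring

theorem metricSq_neg (M : E → E →L[ℝ] E) (x u : E) : metricSq M x (-u) = metricSq M x u := by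
  simp [metricSq]

theorem metricSq_sub_comm (M : E → E →L[ℝ] E) (x u v : E) :
    metricSq M x (u - v) = metricSq M x (v - u) := by
  rw [← metricSq_neg, neg_sub]

theorem abs_inner_apply_le {M : E → E →L[ℝ] E} {x : E} {b : ℝ} (hb : ‖M x‖ ≤ b) (u v : E) :
    |inner ℝ u (M x v)| ≤ b * (‖u‖ * ‖v‖) := by
  calc |inner ℝ u (M x v)| ≤ ‖u‖ * ‖M x v‖ := abs_real_inner_le_norm _ _
    _ ≤ ‖u‖ * (b * ‖v‖) := by gcongr; exact (M x).le_of_opNorm_le hb v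
    _ = _ := by ring

/-- Perturbation of the squared length by a small vector. -/
theorem metricSq_add_le {M : E → E →L[ℝ] E} {x : E} {b : ℝ} (hb : ‖M x‖ ≤ b)
    (hs : ∀ u v, inner ℝ (M x u) v = inner ℝ u (M x v)) (u v : E) :
    metricSq M x (u + v) ≤ metricSq M x u + b * (‖v‖ * (2 * ‖u‖ + ‖v‖)) := by
  rw [metricSq_add hs]
  have h1 := le_of_abs_le (abs_inner_apply_le hb u v)
  have h2 := le_of_abs_le (abs_inner_apply_le hb v v)
  rw [metricSq] at *
  simp only [metricSq]
  nlinarith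

/-- Squared length of the component of `δ` orthogonal to `w`. -/
noncomputable def transverseSq (M : E → E →L[ℝ] E) (x w δ : E) : ℝ :=
  metricSq M x δ - inner ℝ δ (M x w) ^ 2 / metricSq M x w

/-- Coefficient of `w` in the orthogonal projection of `δ`. -/
noncomputable def alongCoeff (M : E → E →L[ℝ] E) (x w δ : E) : ℝ :=
  inner ℝ δ (M x w) / metricSq M x w

/-- Completing the square in `α`: the transverse part is the minimum over all multiples of `w`, so
any convenient `α` gives an upper bound for it. -/
theorem metricSq_sub_smul {M : E → E →L[ℝ] E} {x w : E}
    (hs : ∀ u v, inner ℝ (M x u) v = inner ℝ u (M x v)) (hw : 0 < metricSq M x w) (δ : E) (α : ℝ) :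
    metricSq M x (δ - α • w) =
      transverseSq M x w δ + (α - alongCoeff M x w δ) ^ 2 * metricSq M x w := by
  have h := metricSq_add hs δ (-(α • w))
  rw [← sub_eq_add_neg, metricSq_neg, metricSq_smul] at h
  rw [h, transverseSq, alongCoeff]
  simp only [map_neg, map_smul, inner_neg_right, inner_smul_right]
  field_simp
  ring

theorem transverseSq_le {M : E → E →L[ℝ] E} {x w : E}
    (hs : ∀ u v, inner ℝ (M x u) v = inner ℝ u (M x v)) (hw : 0 < metricSq M x w) (δ : E) (α : ℝ) :
    transverseSq M x w δ ≤ metricSq M x (δ - α • w) := by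
  rw [metricSq_sub_smul hs hw]
  nlinarith [mul_nonneg (sq_nonneg (α - alongCoeff M x w δ)) hw.le]

theorem metricSq_sub_alongCoeff {M : E → E →L[ℝ] E} {x w : E}
    (hs : ∀ u v, inner ℝ (M x u) v = inner ℝ u (M x v)) (hw : 0 < metricSq M x w) (δ : E) :
    metricSq M x (δ - alongCoeff M x w δ • w) = transverseSq M x w δ := by
  rw [metricSq_sub_smul hs hw]; simp

theorem inner_sub_alongCoeff {M : E → E →L[ℝ] E} {x w : E} (hw : 0 < metricSq M x w) (δ : E) :
    inner ℝ (δ - alongCoeff M x w δ • w) (M x w) = 0 := by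
  rw [inner_sub_left, inner_smul_left, alongCoeff]
  change _ - _ * metricSq M x w = 0
  simp only [RCLike.conj_to_real]
  field_simp
  ring

end

/-! ### Riemannian metrics on compact sets -/

section

variable {n : ℕ} {K : Set (EuclideanSpace ℝ (Fin n))}
  {M : EuclideanSpace ℝ (Fin n) → EuclideanSpace ℝ (Fin n) →L[ℝ] EuclideanSpace ℝ (Fin n)}
  {f : EuclideanSpace ℝ (Fin n) → EuclideanSpace ℝ (Fin n)}

/-- Minimum over `K` times the unit sphere, extended by homogeneity. -/
theorem IsRiemannianMetricOn.exists_lower_bound (hM : IsRiemannianMetricOn M K)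
    (hK : IsCompact K) : ∃ a > 0, ∀ x ∈ K, ∀ d, a * ‖d‖ ^ 2 ≤ metricSq M x d := by
  have hc : ContinuousOn (fun p : EuclideanSpace ℝ (Fin n) × EuclideanSpace ℝ (Fin n) =>
      metricSq M p.1 p.2) (K ×ˢ Metric.sphere 0 1) := by
    have h1 : ContinuousOn (fun p : EuclideanSpace ℝ (Fin n) × EuclideanSpace ℝ (Fin n) => M p.1)
        (K ×ˢ Metric.sphere 0 1) :=
      (continuousOn_of_contDiffAt hM.contDiffAt).comp continuousOn_fst fun p hp => hp.1
    exact continuousOn_snd.inner (𝕜 := ℝ) (h1.clm_apply continuousOn_snd)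
  obtain ⟨a, ha, h⟩ := (hK.prod (isCompact_sphere 0 1)).exists_forall_le' hc (a := 0)
    (by
      rintro ⟨x, d⟩ ⟨hx, hd⟩
      refine hM.posDef x hx d ?_
      rintro rfl
      simp at hd)
  refine ⟨a, ha, fun x hx d => ?_⟩
  rcases eq_or_ne d 0 with rfl | hd
  · simp [metricSq]
  have h2 := h (x, ‖d‖⁻¹ • d) ⟨hx, by simp [norm_smul, hd]⟩
  simp only [metricSq_smul] at h2
  have hd' : 0 < ‖d‖ := norm_pos_iff.2 hd
  rw [inv_pow, inv_mul_eq_div, le_div_iff₀ (by positivity)] at h2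
  exact h2

theorem IsRiemannianMetricOn.exists_metricSq_le_add (hM : IsRiemannianMetricOn M K)
    (hK : IsCompact K) {η : ℝ} (hη : 0 < η) :
    ∃ r > 0, ∀ x ∈ K, ∀ y ∈ K, dist x y < r →
      ∀ d, metricSq M x d ≤ metricSq M y d + η * ‖d‖ ^ 2 := by
  obtain ⟨r, hr, h⟩ := Metric.uniformContinuousOn_iff.1
    (hK.uniformContinuousOn_of_continuous (continuousOn_of_contDiffAt hM.contDiffAt)) η hη
  refine ⟨r, hr, fun x hx y hy hxy d => ?_⟩
  have h1 : ‖M x - M y‖ ≤ η := by rw [← dist_eq_norm]; exact (h x hx y hy hxy).le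
  have h2 := le_of_abs_le (abs_inner_apply_le (M := fun _ => M x - M y) (x := x) h1 d d)
  simp only [sub_apply, inner_sub_right] at h2
  simp only [metricSq]
  nlinarith

theorem IsRiemannianMetricOn.pos (hM : IsRiemannianMetricOn M K) {x d : EuclideanSpace ℝ (Fin n)}
    (hx : x ∈ K) (hd : d ≠ 0) : 0 < metricSq M x d := hM.posDef x hx d hd

theorem metricSq_le_norm_sq {x : EuclideanSpace ℝ (Fin n)} {b : ℝ} (hb : ‖M x‖ ≤ b)
    (d : EuclideanSpace ℝ (Fin n)) : metricSq M x d ≤ b * ‖d‖ ^ 2 := by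
  have := le_of_abs_le (abs_inner_apply_le hb d d)
  rw [metricSq]; nlinarith

/-- An `M`-orthogonal projection does not increase `M`-length; passing to the Euclidean norm and
back costs `√(b / a)`. -/
theorem IsRiemannianMetricOn.norm_sub_alongCoeff_le (hM : IsRiemannianMetricOn M K) {a b : ℝ}
    (ha : 0 < a) {x w : EuclideanSpace ℝ (Fin n)} (hx : x ∈ K)
    (hlow : ∀ d, a * ‖d‖ ^ 2 ≤ metricSq M x d) (hb : ‖M x‖ ≤ b) (hw : w ≠ 0)
    (d : EuclideanSpace ℝ (Fin n)) : ‖d - alongCoeff M x w d • w‖ ≤ √(b / a) * ‖d‖ := by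
  have hs := hM.symmetric x hx
  have hw' := hM.pos hx hw
  have h1 := hlow (d - alongCoeff M x w d • w)
  rw [metricSq_sub_alongCoeff hs hw'] at h1
  have h2 := transverseSq_le hs hw' d 0
  rw [zero_smul, sub_zero] at h2
  have h3 := metricSq_le_norm_sq hb d
  have hb0 : 0 ≤ b := (norm_nonneg _).trans hb
  rw [← Real.sqrt_sq (norm_nonneg (d - _)), ← Real.sqrt_sq (norm_nonneg d),
    ← Real.sqrt_mul (by positivity)]
  apply Real.sqrt_le_sqrt
  rw [div_mul_eq_mul_div, le_div_iff₀ ha]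
  linarith

/-- Shows that the side condition of transverse contraction is `M`-orthogonality of `δ` to `f x`. -/
theorem IsRiemannianMetricOn.fderiv_metricNorm_right (hM : IsRiemannianMetricOn M K)
    {x δ : EuclideanSpace ℝ (Fin n)} (hx : x ∈ K) (hδ : δ ≠ 0) (w : EuclideanSpace ℝ (Fin n)) :
    fderiv ℝ (fun d => metricNorm M x d) δ w = inner ℝ δ (M x w) / metricNorm M x δ := by
  have hpos := hM.pos hx hδ
  have h := (((hasFDerivAt_id δ).inner ℝ ((M x).hasFDerivAt (x := δ))).sqrt hpos.ne')
  have h2 : HasFDerivAt (fun d => metricNorm M x d) _ δ := h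
  rw [h2.fderiv]
  simp only [id, smul_apply, ContinuousLinearMap.comp_apply, ContinuousLinearMap.prod_apply,
    fderivInnerCLM_apply, smul_eq_mul, metricNorm]
  have h3 : inner ℝ w (M x δ) = inner ℝ δ (M x w) := by
    rw [← hM.symmetric x hx w δ, real_inner_comm]
  simp only [ContinuousLinearMap.id_apply, h3]
  ring

theorem IsRiemannianMetricOn.fderiv_metricNorm_left (hM : IsRiemannianMetricOn M K)
    {x δ : EuclideanSpace ℝ (Fin n)} (hx : x ∈ K) (hδ : δ ≠ 0) (w : EuclideanSpace ℝ (Fin n)) :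
    fderiv ℝ (fun y => metricNorm M y δ) x w =
      inner ℝ δ (fderiv ℝ M x w δ) / (2 * metricNorm M x δ) := by
  have hpos := hM.pos hx hδ
  have h0 : HasFDerivAt M (fderiv ℝ M x) x :=
    ((hM.contDiffAt x hx).differentiableAt one_ne_zero).hasFDerivAt
  have h := (((hasFDerivAt_const δ x).inner ℝ (h0.clm_apply (hasFDerivAt_const δ x))).sqrt hpos.ne')
  have h2 : HasFDerivAt (fun y => metricNorm M y δ) _ x := h
  rw [h2.fderiv]
  simp [metricNorm]
  ring

/-- Transverse contraction as an inequality between quadratic forms. -/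
theorem TransverseContracting.quadratic {lam : ℝ} (h : TransverseContracting f M lam K)
    (hM : IsRiemannianMetricOn M K) {x δ : EuclideanSpace ℝ (Fin n)} (hx : x ∈ K)
    (hδ : inner ℝ δ (M x (f x)) = 0) :
    inner ℝ δ (fderiv ℝ M x (f x) δ) + 2 * inner ℝ δ (M x (fderiv ℝ f x δ)) ≤
      -(2 * lam) * metricSq M x δ := by
  rcases eq_or_ne δ 0 with rfl | h0
  · simp [metricSq]
  have h1 := h x hx δ h0
    (by rw [hM.fderiv_metricNorm_right hx h0, hδ, zero_div])
  rw [hM.fderiv_metricNorm_right hx h0, hM.fderiv_metricNorm_left hx h0] at h1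
  have hV : 0 < metricNorm M x δ := Real.sqrt_pos.2 (hM.pos hx h0)
  have hV2 : metricNorm M x δ ^ 2 = metricSq M x δ := Real.sq_sqrt (hM.pos hx h0).le
  rw [← hV2]
  have h2 : inner ℝ δ (fderiv ℝ M x (f x) δ) / (2 * metricNorm M x δ) +
      inner ℝ δ (M x (fderiv ℝ f x δ)) / metricNorm M x δ =
      (inner ℝ δ (fderiv ℝ M x (f x) δ) + 2 * inner ℝ δ (M x (fderiv ℝ f x δ))) /
        (2 * metricNorm M x δ) := by field_simp
  rw [h2, div_le_iff₀ (by positivity)] at h1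
  nlinarith

/-- Decay of the transverse distance between two nearby trajectories. -/
theorem IsRiemannianMetricOn.transverseSq_trajectories_le (hM : IsRiemannianMetricOn M K)
    (hf : ∀ x ∈ K, ContDiffAt ℝ 1 f x) (hf0 : ∀ x ∈ K, f x ≠ 0) {lam : ℝ} (hlam : 0 < lam)
    (hcontr : TransverseContracting f M lam K) {a b : ℝ} (ha : 0 < a)
    (hlow : ∀ x ∈ K, ∀ d, a * ‖d‖ ^ 2 ≤ metricSq M x d) (hb : ∀ x ∈ K, ‖M x‖ ≤ b)
    {u v : ℝ → EuclideanSpace ℝ (Fin n)} {m ε D : ℝ} (hm : 0 ≤ m) (hε : 0 ≤ ε)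
    (hu : ContinuousOn u (Icc 0 m)) (hv : ContinuousOn v (Icc 0 m))
    (hu' : ∀ t ∈ Ico 0 m, HasDerivWithinAt u (f (u t)) (Ici t) t)
    (hv' : ∀ t ∈ Ico 0 m, HasDerivWithinAt v (f (v t)) (Ici t) t)
    (huK : ∀ t ∈ Icc 0 m, u t ∈ K)
    (hD : ∀ t ∈ Ico 0 m, ‖v t - u t‖ ≤ D)
    (hdiff : ∀ t ∈ Ico 0 m,
      ‖f (v t) - f (u t) - fderiv ℝ f (u t) (v t - u t)‖ ≤ ε * ‖v t - u t‖) :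
    transverseSq M (u m) (f (u m)) (v m - u m) ≤
      Real.exp (-(2 * lam) * m) * transverseSq M (u 0) (f (u 0)) (v 0 - u 0) +
        b * √(b / a) * ε * D ^ 2 / lam := by
  set W : ℝ → ℝ := fun t => transverseSq M (u t) (f (u t)) (v t - u t) with hW
  have h0m : (0 : ℝ) ∈ Icc 0 m := left_mem_Icc.2 hm
  have hb0 : 0 ≤ b := (norm_nonneg _).trans (hb _ (huK 0 h0m))
  -- Bound for `2 ⟪p, M e⟫`, with `‖p‖ ≤ √(b / a) * D` for the transverse part and `‖e‖ ≤ ε * D` for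
  -- the Taylor remainder of `f`.
  set E : ℝ := 2 * b * √(b / a) * ε * D ^ 2 with hE
  have hE0 : 0 ≤ E := by positivity
  have hMu : ContinuousOn (fun t => M (u t)) (Icc 0 m) :=
    (continuousOn_of_contDiffAt hM.contDiffAt).comp hu huK
  have hfu : ContinuousOn (fun t => f (u t)) (Icc 0 m) := (continuousOn_of_contDiffAt hf).comp hu huK
  have hWc : ContinuousOn W (Icc 0 m) := by
    have h1 : ContinuousOn (fun t => metricSq M (u t) (v t - u t)) (Icc 0 m) :=
      (hv.sub hu).inner (𝕜 := ℝ) (hMu.clm_apply (hv.sub hu))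
    have h2 : ContinuousOn (fun t => inner ℝ (v t - u t) (M (u t) (f (u t)))) (Icc 0 m) :=
      (hv.sub hu).inner (𝕜 := ℝ) (hMu.clm_apply hfu)
    have h3 : ContinuousOn (fun t => metricSq M (u t) (f (u t))) (Icc 0 m) :=
      hfu.inner (𝕜 := ℝ) (hMu.clm_apply hfu)
    exact h1.sub ((h2.pow 2).div h3 fun t ht => (hM.pos (huK t ht) (hf0 _ (huK t ht))).ne')
  have key : ∀ t ∈ Ico 0 m, ∀ r, -(2 * lam) * W t + E < r →
      ∃ᶠ s in 𝓝[>] t, (s - t)⁻¹ * (W s - W t) < r := by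
    intro t ht r hr
    have htI := Ico_subset_Icc_self ht
    have hx := huK t htI
    have hs := hM.symmetric _ hx
    have hw := hM.pos hx (hf0 _ hx)
    -- The coefficient is frozen at time `t`. By minimality `W ≤ φ` afterwards, with equality at
    -- `t`, so the right slopes of `W` are at most those of `φ` and `W` itself need not be
    -- differentiated.
    set α := alongCoeff M (u t) (f (u t)) (v t - u t) with hα
    set p := v t - u t - α • f (u t) with hp
    set e := f (v t) - f (u t) - fderiv ℝ f (u t) (v t - u t) with he
    set φ : ℝ → ℝ := fun s => metricSq M (u s) (v s - u s - α • f (u s)) with hφ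
    have hMd : HasDerivWithinAt (fun s => M (u s)) (fderiv ℝ M (u t) (f (u t))) (Ici t) t :=
      ((hM.contDiffAt _ hx).differentiableAt one_ne_zero).hasFDerivAt.comp_hasDerivWithinAt t
        (hu' t ht)
    have hfd : HasDerivWithinAt (fun s => f (u s)) (fderiv ℝ f (u t) (f (u t))) (Ici t) t :=
      ((hf _ hx).differentiableAt one_ne_zero).hasFDerivAt.comp_hasDerivWithinAt t (hu' t ht)
    have hδd := ((hv' t ht).sub (hu' t ht)).sub (hfd.const_smul α)
    have hφd := hδd.inner ℝ (hMd.clm_apply hδd)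
    have hφd' : HasDerivWithinAt φ _ (Ici t) t := hφd
    have hφt : φ t = W t := metricSq_sub_alongCoeff hs hw _
    have hp0 : inner ℝ p (M (u t) (f (u t))) = 0 := inner_sub_alongCoeff hw _
    have hq := hcontr.quadratic hM hx hp0
    -- `f (u s)` solves the variational equation along `u`, so subtracting a fixed multiple of it
    -- leaves `Df p` plus the remainder.
    have hpe : f (v t) - f (u t) - α • fderiv ℝ f (u t) (f (u t)) = fderiv ℝ f (u t) p + e := by
      simp only [hp, he, map_sub, map_smul]; abel
    have hpn : ‖p‖ ≤ √(b / a) * ‖v t - u t‖ :=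
      hM.norm_sub_alongCoeff_le ha hx (hlow _ hx) (hb _ hx) (hf0 _ hx) _
    have herr : 2 * inner ℝ p (M (u t) e) ≤ E := by
      have h1 := le_of_abs_le (abs_inner_apply_le (hb _ hx) p e)
      have hd := hD t ht
      have h2 : ‖p‖ * ‖e‖ ≤ (√(b / a) * D) * (ε * D) := by
        have hD0 : 0 ≤ D := (norm_nonneg _).trans hd
        exact mul_le_mul (hpn.trans (by gcongr)) ((hdiff t ht).trans (by gcongr))
          (norm_nonneg _) (by positivity)
      have h3 := mul_le_mul_of_nonneg_left h2 hb0
      rw [hE]; linarith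
    have hd : ∀ y, HasDerivWithinAt φ y (Ici t) t → y ≤ -(2 * lam) * W t + E →
        ∃ᶠ s in 𝓝[>] t, (s - t)⁻¹ * (W s - W t) < r := by
      intro y hy hyle
      have h1 := hy.liminf_right_slope_le (hyle.trans_lt hr)
      have hmem : ∀ᶠ s in 𝓝[>] t, s ∈ Ioo t m := Ioo_mem_nhdsGT ht.2
      refine (h1.and_eventually hmem).mono ?_
      rintro s ⟨hs1, hs2⟩
      refine lt_of_le_of_lt ?_ hs1
      have hsI : s ∈ Icc 0 m := ⟨ht.1.trans hs2.1.le, hs2.2.le⟩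
      have h4 : W s ≤ φ s := transverseSq_le (hM.symmetric _ (huK s hsI))
        (hM.pos (huK s hsI) (hf0 _ (huK s hsI))) _ _
      rw [slope_def_field, hφt, inv_mul_eq_div]
      have : 0 < s - t := sub_pos.2 hs2.1
      gcongr
    refine hd _ hφd' ?_
    have hs' : inner ℝ (f (v t) - f (u t) - α • fderiv ℝ f (u t) (f (u t))) (M (u t) p) =
        inner ℝ p (M (u t) (f (v t) - f (u t) - α • fderiv ℝ f (u t) (f (u t)))) := by
      rw [← hs, real_inner_comm]
    rw [← hφt]
    have hφt' : φ t = metricSq M (u t) p := rfl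
    rw [hφt']
    simp only [Pi.sub_apply, Pi.smul_apply, ← hp]
    rw [hs', hpe, map_add, inner_add_right, inner_add_right]
    linarith
  have hfin := le_gronwallBound_of_liminf_deriv_right_le (f := W)
    (f' := fun t => -(2 * lam) * W t + E) (K := -(2 * lam)) (ε := E) hWc key le_rfl
    (fun _ _ => le_rfl) m (right_mem_Icc.2 hm)
  rw [gronwallBound_of_K_ne_0 (by linarith), sub_zero] at hfin
  refine hfin.trans ?_
  have hexp : 0 < Real.exp (-(2 * lam) * m) := Real.exp_pos _
  have h5 : E / -(2 * lam) * (Real.exp (-(2 * lam) * m) - 1) =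
      E / (2 * lam) * (1 - Real.exp (-(2 * lam) * m)) := by
    field_simp; ring
  have h6 : E / (2 * lam) * (1 - Real.exp (-(2 * lam) * m)) ≤ E / (2 * lam) := by
    have : 0 ≤ E / (2 * lam) := by positivity
    nlinarith
  have h7 : E / (2 * lam) = b * √(b / a) * ε * D ^ 2 / lam := by
    rw [hE]; field_simp
  dsimp only at *
  rw [h5]
  linarith [mul_comm (W 0) (Real.exp (-(2 * lam) * m))]

end

/-! ### Solutions of hybrid systems -/

section

variable {n : ℕ} {f g : EuclideanSpace ℝ (Fin n) → EuclideanSpace ℝ (Fin n)}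
  {S : Set (EuclideanSpace ℝ (Fin n))}

/-- A solution of the hybrid system on the time interval `[0, σ)`. -/
structure IsHybridSolutionOn (f g : EuclideanSpace ℝ (Fin n) → EuclideanSpace ℝ (Fin n))
    (S : Set (EuclideanSpace ℝ (Fin n))) (x : ℝ → EuclideanSpace ℝ (Fin n)) (σ : ℝ) : Prop where
  notMem : ∀ t ∈ Ico 0 σ, x t ∉ S
  flow : ∀ t ∈ Ico 0 σ, HasDerivWithinAt x (f (x t)) (Ici t) t
  impulse : ∀ t ∈ Ioo 0 σ,
    ∃ y : EuclideanSpace ℝ (Fin n), Tendsto x (𝓝[<] t) (𝓝 y) ∧ IsPostState g S y (x t)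

/-- A piece of trajectory that ends on the surface `S` at its first arrival there. -/
structure IsFlowArc (f : EuclideanSpace ℝ (Fin n) → EuclideanSpace ℝ (Fin n))
    (S : Set (EuclideanSpace ℝ (Fin n))) (u : ℝ → EuclideanSpace ℝ (Fin n)) (τ : ℝ) : Prop where
  pos : 0 < τ
  cont : ContinuousOn u (Icc 0 τ)
  flow : ∀ t ∈ Ico 0 τ, HasDerivWithinAt u (f (u t)) (Ici t) t
  notMem : ∀ t ∈ Ico 0 τ, u t ∉ S
  mem : u τ ∈ S

theorem IsPostState.unique {y w w' : EuclideanSpace ℝ (Fin n)} (h : IsPostState g S y w)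
    (h' : IsPostState g S y w') : w = w' := by
  by_cases hy : y ∈ S
  · rw [h.1 hy, h'.1 hy]
  · rw [h.2 hy, h'.2 hy]

theorem isPostState_of_notMem {y : EuclideanSpace ℝ (Fin n)} (hy : y ∉ S) :
    IsPostState g S y y := ⟨fun h => absurd h hy, fun _ => rfl⟩

theorem isPostState_of_mem {y : EuclideanSpace ℝ (Fin n)} (hy : y ∈ S) :
    IsPostState g S y (g y) := ⟨fun _ => rfl, fun h => absurd hy h⟩

theorem IsHybridSolution.on {x : ℝ → EuclideanSpace ℝ (Fin n)} (hx : IsHybridSolution f g S x)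
    (σ : ℝ) : IsHybridSolutionOn f g S x σ :=
  ⟨fun t ht => hx.notMem t ht.1, fun t ht => hx.flow t ht.1, fun t ht => hx.impulse t ht.1⟩

theorem IsFlowArc.tendsto_left {u : ℝ → EuclideanSpace ℝ (Fin n)} {τ t : ℝ}
    (hu : IsFlowArc f S u τ) (ht : t ∈ Ioc 0 τ) : Tendsto u (𝓝[<] t) (𝓝 (u t)) := by
  have h := hu.cont t (Ioc_subset_Icc_self ht)
  refine h.mono_left (nhdsWithin_le_of_mem ?_)
  exact mem_of_superset (Ioo_mem_nhdsLT ht.1) fun s hs => ⟨hs.1.le, hs.2.le.trans ht.2⟩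

theorem IsFlowArc.on {u : ℝ → EuclideanSpace ℝ (Fin n)} {τ : ℝ} (hu : IsFlowArc f S u τ) :
    IsHybridSolutionOn f g S u τ :=
  ⟨hu.notMem, hu.flow, fun t ht => ⟨u t, hu.tendsto_left ⟨ht.1, ht.2.le⟩,
    isPostState_of_notMem (hu.notMem t ⟨ht.1.le, ht.2⟩)⟩⟩

theorem tendsto_add_const_nhdsLT (s t : ℝ) : Tendsto (fun r => r + s) (𝓝[<] t) (𝓝[<] (t + s)) := by
  refine tendsto_nhdsWithin_iff.2 ⟨?_, ?_⟩
  · exact ((continuous_add_const s).tendsto t).mono_left nhdsWithin_le_nhds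
  · filter_upwards [self_mem_nhdsWithin] with r hr
    simpa using hr

theorem HasDerivWithinAt.comp_add_const_Ici {x : ℝ → EuclideanSpace ℝ (Fin n)}
    {x' : EuclideanSpace ℝ (Fin n)} {s t : ℝ} (h : HasDerivWithinAt x x' (Ici (t + s)) (t + s)) :
    HasDerivWithinAt (fun r => x (r + s)) x' (Ici t) t := by
  have h1 : HasDerivWithinAt (fun r : ℝ => r + s) 1 (Ici t) t :=
    ((hasDerivAt_id t).add_const s).hasDerivWithinAt
  have := h.scomp t h1 (fun r hr => by simpa using hr)
  rw [one_smul] at this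
  exact this

theorem IsHybridSolution.shift {x : ℝ → EuclideanSpace ℝ (Fin n)} (hx : IsHybridSolution f g S x)
    {s : ℝ} (hs : 0 ≤ s) : IsHybridSolution f g S (fun t => x (t + s)) where
  notMem t ht := hx.notMem _ (by linarith)
  flow t ht := (hx.flow (t + s) (by linarith)).comp_add_const_Ici
  impulse t ht := by
    obtain ⟨y, hy, h⟩ := hx.impulse (t + s) (by linarith)
    exact ⟨y, hy.comp (tendsto_add_const_nhdsLT s t), h⟩

/-- Shortly after any time a hybrid solution is continuous and stays close to its state. -/
theorem IsHybridSolutionOn.exists_continuousOn_Icc {x : ℝ → EuclideanSpace ℝ (Fin n)} {σ : ℝ}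
    (hx : IsHybridSolutionOn f g S x σ) (hS : IsClosed S) {t : ℝ} (ht : t ∈ Ico 0 σ)
    {U : Set (EuclideanSpace ℝ (Fin n))} (hU : U ∈ 𝓝 (x t)) :
    ∃ η > 0, t + η < σ ∧ ContinuousOn x (Icc t (t + η)) ∧ (∀ s ∈ Icc t (t + η), x s ∈ U) ∧
      ∀ s ∈ Ioc t (t + η), Tendsto x (𝓝[<] s) (𝓝 (x s)) := by
  have hmem : U ∩ Sᶜ ∈ 𝓝 (x t) := inter_mem hU (hS.isOpen_compl.mem_nhds (hx.notMem t ht))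
  -- A closed ball also contains left limits, so these are off `S` and no impulse takes place.
  obtain ⟨ρ, hρ, hball⟩ := Metric.nhds_basis_closedBall.mem_iff.1 hmem
  have hr := (hx.flow t ht).continuousWithinAt.preimage_mem_nhdsWithin
    (Metric.closedBall_mem_nhds (x t) hρ)
  obtain ⟨c, hc, hcsub⟩ := mem_nhdsGE_iff_exists_Icc_subset.1
    (inter_mem hr (mem_nhdsWithin_of_mem_nhds (Iio_mem_nhds ht.2)))
  have hct : t < c := hc
  have hcσ : c < σ := (hcsub (right_mem_Icc.2 hct.le)).2
  have hleft : ∀ s ∈ Ioc t c, Tendsto x (𝓝[<] s) (𝓝 (x s)) := by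
    intro s hs
    obtain ⟨y, hy, hpost⟩ := hx.impulse s ⟨ht.1.trans_lt hs.1, hs.2.trans_lt hcσ⟩
    have hyb : y ∈ Metric.closedBall (x t) ρ := by
      refine Metric.isClosed_closedBall.mem_of_tendsto hy ?_
      filter_upwards [Ioo_mem_nhdsLT hs.1] with r hr
      exact (hcsub ⟨hr.1.le, hr.2.le.trans hs.2⟩).1
    rwa [hpost.2 (hball hyb).2]
  refine ⟨c - t, by linarith, by linarith, ?_, ?_, ?_⟩
  · rw [add_sub_cancel]
    intro s hs
    have hsr := (hx.flow s ⟨ht.1.trans hs.1, hs.2.trans_lt hcσ⟩).continuousWithinAt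
    rcases hs.1.eq_or_lt with rfl | hlt
    · exact hsr.mono Icc_subset_Ici_self
    · refine ContinuousAt.continuousWithinAt (continuousAt_iff_continuous_left'_right'.2
        ⟨?_, hsr.mono Ioi_subset_Ici_self⟩)
      exact hleft s ⟨hlt, hs.2⟩
  · rw [add_sub_cancel]
    exact fun s hs => (hball (hcsub hs).1).1
  · rw [add_sub_cancel]
    exact hleft

/-- Agreement up to the supremum `T` of agreement times passes to `T`, since the left limit
determines the state after it. Local uniqueness for the differential equation then carries it past
`T`. -/
theorem IsHybridSolutionOn.eqOn {x y : ℝ → EuclideanSpace ℝ (Fin n)} {σ : ℝ}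
    (hx : IsHybridSolutionOn f g S x σ) (hy : IsHybridSolutionOn f g S y σ) (hS : IsClosed S)
    (hf : ∀ t ∈ Ico 0 σ, ContDiffAt ℝ 1 f (x t)) (h0 : x 0 = y 0) : EqOn x y (Ico 0 σ) := by
  intro s hs
  set A : Set ℝ := {t | t ∈ Icc 0 s ∧ EqOn x y (Icc 0 t)} with hA
  have h0A : (0 : ℝ) ∈ A := ⟨left_mem_Icc.2 hs.1, fun r hr => by
    rw [Icc_self] at hr; rw [mem_singleton_iff.1 hr, h0]⟩
  have hbdd : BddAbove A := ⟨s, fun t ht => ht.1.2⟩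
  set T := sSup A with hT
  have hT0 : 0 ≤ T := le_csSup hbdd h0A
  have hTs : T ≤ s := csSup_le ⟨0, h0A⟩ fun t ht => ht.1.2
  have hlt : ∀ t, 0 ≤ t → t < T → x t = y t := by
    intro t ht htT
    obtain ⟨t', ht', htt'⟩ := exists_lt_of_lt_csSup ⟨0, h0A⟩ htT
    exact ht'.2 ⟨ht, htt'.le⟩
  have hTσ : T ∈ Ico 0 σ := ⟨hT0, hTs.trans_lt hs.2⟩
  have hTeq : x T = y T := by
    rcases hT0.eq_or_lt with h | h
    · rw [← h, h0]
    obtain ⟨p, hp, hpost⟩ := hx.impulse T ⟨h, hTσ.2⟩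
    obtain ⟨q, hq, hpost'⟩ := hy.impulse T ⟨h, hTσ.2⟩
    have hpq : p = q := by
      refine tendsto_nhds_unique hp (hq.congr' ?_)
      filter_upwards [Ioo_mem_nhdsLT h] with r hr
      exact (hlt r hr.1.le hr.2).symm
    rw [← hpq] at hpost'
    exact hpost.unique hpost'
  have hle : ∀ t, 0 ≤ t → t ≤ T → x t = y t := fun t ht htT =>
    htT.eq_or_lt.elim (fun h => h ▸ hTeq) (hlt t ht)
  rcases hTs.eq_or_lt with h | h
  · rw [← h]; exact hTeq
  exfalso
  obtain ⟨L, U, hU, hL⟩ := (hf T hTσ).exists_lipschitzOnWith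
  obtain ⟨η, hη, -, hxc, hxU, -⟩ := hx.exists_continuousOn_Icc hS hTσ hU
  obtain ⟨η', hη', -, hyc, hyU, -⟩ := hy.exists_continuousOn_Icc hS hTσ (hTeq ▸ hU)
  set c := min (min (T + η) (T + η')) s with hc
  have hTc : T < c := lt_min (lt_min (by linarith) (by linarith)) h
  have hc1 : c ≤ T + η := (min_le_left _ _).trans (min_le_left _ _)
  have hc2 : c ≤ T + η' := (min_le_left _ _).trans (min_le_right _ _)
  have hcs : c ≤ s := min_le_right _ _
  have heq : EqOn x y (Icc T c) := by
    refine ODE_solution_unique_of_mem_Icc_right (v := fun _ => f) (s := fun _ => U)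
      (fun _ _ => hL) (hxc.mono (Icc_subset_Icc_right hc1)) ?_ ?_
      (hyc.mono (Icc_subset_Icc_right hc2)) ?_ ?_ hTeq
    · exact fun t ht => hx.flow t ⟨hT0.trans ht.1, (ht.2.le.trans hcs).trans_lt hs.2⟩
    · exact fun t ht => hxU t ⟨ht.1, ht.2.le.trans hc1⟩
    · exact fun t ht => hy.flow t ⟨hT0.trans ht.1, (ht.2.le.trans hcs).trans_lt hs.2⟩
    · exact fun t ht => hyU t ⟨ht.1, ht.2.le.trans hc2⟩
  have hcA : c ∈ A := ⟨⟨hT0.trans hTc.le, hcs⟩, fun t ht =>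
    (le_total t T).elim (hle t ht.1) fun h => heq ⟨h, ht.2⟩⟩
  exact absurd (le_csSup hbdd hcA) (not_le.2 hTc)

theorem IsHybridSolution.eqOn {x y : ℝ → EuclideanSpace ℝ (Fin n)}
    (hx : IsHybridSolution f g S x) (hy : IsHybridSolution f g S y) (hS : IsClosed S)
    (hf : ∀ t, 0 ≤ t → ContDiffAt ℝ 1 f (x t)) (h0 : x 0 = y 0) : EqOn x y (Ici 0) := fun t ht =>
  (hx.on (t + 1)).eqOn (hy.on (t + 1)) hS (fun s hs => hf s hs.1) h0 ⟨ht, lt_add_one t⟩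

/-- The part of a hybrid solution before its first arrival at `S`. -/
theorem IsHybridSolution.exists_isFlowArc {x : ℝ → EuclideanSpace ℝ (Fin n)}
    (hx : IsHybridSolution f g S x) (hS : IsClosed S)
    (h : ∃ t : ℝ, 0 < t ∧ ∃ y ∈ S, Tendsto x (𝓝[<] t) (𝓝 y)) :
    ∃ u τ, IsFlowArc f S u τ ∧ EqOn u x (Ico 0 τ) ∧ Tendsto x (𝓝[<] τ) (𝓝 (u τ)) := by
  set Z : Set ℝ := {t | 0 < t ∧ ∃ y ∈ S, Tendsto x (𝓝[<] t) (𝓝 y)} with hZ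
  have hbdd : BddBelow Z := ⟨0, fun t ht => ht.1.le⟩
  set τ := sInf Z with hτ
  have hτ0 : 0 ≤ τ := le_csInf h fun t ht => ht.1.le
  have hτZ : τ ∈ Z := by
    -- If the infimum were not attained, there would be arrivals just after `τ`, where the solution
    -- is continuous and off `S`.
    by_contra hcon
    obtain ⟨η, hη, -, -, hmem, htend⟩ := (hx.on (τ + 1)).exists_continuousOn_Icc hS
      ⟨hτ0, lt_add_one τ⟩ univ_mem
    obtain ⟨t, htZ, ht⟩ := exists_lt_of_csInf_lt h (show sInf Z < τ + η by linarith)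
    have hτt : τ < t := lt_of_le_of_ne (csInf_le hbdd htZ) fun h' => hcon (h' ▸ htZ)
    obtain ⟨ht0, y, hyS, hy⟩ := htZ
    have := tendsto_nhds_unique hy (htend t ⟨hτt, ht.le⟩)
    exact hx.notMem t ht0.le (this ▸ hyS)
  have hlt : ∀ t ∈ Ioo 0 τ, ContinuousAt x t := by
    intro t ht
    obtain ⟨y, hy, hpost⟩ := hx.impulse t ht.1
    have hyS : y ∉ S := fun hyS => not_le.2 ht.2 (csInf_le hbdd ⟨ht.1, y, hyS, hy⟩)
    rw [← hpost.2 hyS] at hy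
    exact continuousAt_iff_continuous_left'_right'.2
      ⟨hy, (hx.flow t ht.1.le).continuousWithinAt.mono Ioi_subset_Ici_self⟩
  obtain ⟨hτpos, y, hyS, hy⟩ := hτZ
  -- The arc must end at the state before the impulse, so the value at `τ` is replaced by the left
  -- limit.
  have hne : ∀ t ∈ Ico 0 τ, Function.update x τ y t = x t := fun t ht =>
    Function.update_of_ne ht.2.ne _ _
  have hev : ∀ t ∈ Ico 0 τ, Function.update x τ y =ᶠ[𝓝 t] x := fun t ht => by
    filter_upwards [Iio_mem_nhds ht.2] with s hs using Function.update_of_ne (ne_of_lt hs) _ _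
  refine ⟨Function.update x τ y, τ, ⟨hτpos, ?_, ?_, ?_, ?_⟩, hne, ?_⟩
  · intro t ht
    rcases ht.2.eq_or_lt with rfl | htτ
    · rw [continuousWithinAt_update_same]
      refine hy.mono_left (nhdsWithin_mono _ ?_)
      rintro s ⟨hs, hne⟩
      exact lt_of_le_of_ne hs.2 hne
    · have hc : ContinuousWithinAt x (Icc 0 τ) t := by
        rcases ht.1.eq_or_lt with rfl | ht0
        · exact (hx.flow 0 le_rfl).continuousWithinAt.mono Icc_subset_Ici_self
        · exact (hlt t ⟨ht0, htτ⟩).continuousWithinAt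
      exact hc.congr_of_eventuallyEq ((hev t ⟨ht.1, htτ⟩).filter_mono nhdsWithin_le_nhds)
        (hne t ⟨ht.1, htτ⟩)
  · intro t ht
    rw [hne t ht]
    exact (hx.flow t ht.1).congr_of_eventuallyEq ((hev t ht).filter_mono nhdsWithin_le_nhds)
      (hne t ht)
  · intro t ht
    rw [hne t ht]
    exact hx.notMem t ht.1
  · simpa using hyS
  · simpa using hy

/-- An arc followed by a hybrid solution that starts at the state after the impulse. -/
theorem IsFlowArc.concat {u x : ℝ → EuclideanSpace ℝ (Fin n)} {τ : ℝ} (hu : IsFlowArc f S u τ)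
    (hx : IsHybridSolution f g S x) (h0 : x 0 = g (u τ)) :
    IsHybridSolution f g S (fun t => if t < τ then u t else x (t - τ)) := by
  set w : ℝ → EuclideanSpace ℝ (Fin n) := fun t => if t < τ then u t else x (t - τ) with hw
  have hwu : ∀ t, t < τ → w t = u t := fun t ht => if_pos ht
  have hwx : ∀ t, τ ≤ t → w t = x (t - τ) := fun t ht => if_neg (not_lt.2 ht)
  have hleft : ∀ t ≤ τ, w =ᶠ[𝓝[<] t] u := fun t ht => by
    filter_upwards [self_mem_nhdsWithin] with s hs
    exact hwu s (lt_of_lt_of_le hs ht)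
  refine ⟨fun t ht => ?_, fun t ht => ?_, fun t ht => ?_⟩
  · rcases lt_or_ge t τ with h | h
    · rw [hwu t h]; exact hu.notMem t ⟨ht, h⟩
    · rw [hwx t h]; exact hx.notMem _ (by linarith)
  · rcases lt_or_ge t τ with h | h
    · rw [hwu t h]
      refine (hu.flow t ⟨ht, h⟩).congr_of_eventuallyEq ?_ (hwu t h)
      filter_upwards [mem_nhdsWithin_of_mem_nhds (Iio_mem_nhds h)] with s hs using hwu s hs
    · rw [hwx t h]
      have h1 : HasDerivWithinAt (fun s => x (s + -τ)) (f (x (t - τ))) (Ici t) t :=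
        HasDerivWithinAt.comp_add_const_Ici (hx.flow (t + -τ) (by linarith))
      refine h1.congr (fun s hs => ?_) (hwx t h)
      exact hwx s (h.trans hs)
  · rcases lt_trichotomy t τ with h | rfl | h
    · refine ⟨u t, (hu.tendsto_left ⟨ht, h.le⟩).congr' (hleft t h.le).symm, ?_⟩
      rw [hwu t h]
      exact isPostState_of_notMem (hu.notMem t ⟨ht.le, h⟩)
    · refine ⟨u t, (hu.tendsto_left ⟨ht, le_rfl⟩).congr' (hleft t le_rfl).symm, ?_⟩
      rw [hwx t le_rfl, sub_self, h0]
      exact isPostState_of_mem hu.mem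
    · obtain ⟨y, hy, hpost⟩ := hx.impulse (t - τ) (by linarith)
      refine ⟨y, ?_, by rwa [hwx t h.le]⟩
      have h1 : Tendsto (fun s => x (s + -τ)) (𝓝[<] t) (𝓝 y) :=
        Tendsto.comp hy (tendsto_add_const_nhdsLT (-τ) t)
      refine h1.congr' ?_
      filter_upwards [Ioo_mem_nhdsLT h] with s hs
      rw [hwx s hs.1.le, sub_eq_add_neg]

/-- A hybrid solution follows each arc that starts at its initial state, and is at the end of the
arc subject to an impulse. -/
theorem IsFlowArc.eqOn {u x : ℝ → EuclideanSpace ℝ (Fin n)} {τ : ℝ} (hu : IsFlowArc f S u τ)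
    (hS : IsClosed S) (hf : ∀ t ∈ Ico 0 τ, ContDiffAt ℝ 1 f (u t))
    (hx : IsHybridSolution f g S x) (h0 : u 0 = x 0) :
    EqOn u x (Ico 0 τ) ∧ Tendsto x (𝓝[<] τ) (𝓝 (u τ)) ∧ x τ = g (u τ) := by
  have heq := hu.on.eqOn (hx.on τ) hS hf h0
  have htend : Tendsto x (𝓝[<] τ) (𝓝 (u τ)) := by
    refine (hu.tendsto_left ⟨hu.pos, le_rfl⟩).congr' ?_
    filter_upwards [Ioo_mem_nhdsLT hu.pos] with s hs using heq ⟨hs.1.le, hs.2⟩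
  refine ⟨heq, htend, ?_⟩
  obtain ⟨y, hy, hpost⟩ := hx.impulse τ hu.pos
  rw [tendsto_nhds_unique htend hy]
  exact hpost.1 (tendsto_nhds_unique htend hy ▸ hu.mem)

end

/-! ### Flights inside an invariant set -/

section

variable {n : ℕ} {f g : EuclideanSpace ℝ (Fin n) → EuclideanSpace ℝ (Fin n)}
  {z : EuclideanSpace ℝ (Fin n)} {b : ℝ} {K : Set (EuclideanSpace ℝ (Fin n))}

/-- A hybrid system with a single continuous phase `K` that is strictly forward invariant and
from which all solutions reach the switching surface transversally. -/
structure IsSinglePhase (f g : EuclideanSpace ℝ (Fin n) → EuclideanSpace ℝ (Fin n))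
    (z : EuclideanSpace ℝ (Fin n)) (b : ℝ) (K : Set (EuclideanSpace ℝ (Fin n))) : Prop where
  normal_ne_zero : z ≠ 0
  compact : IsCompact K
  side : ∀ x ∈ K, inner ℝ z x - b ≤ 0
  connected : IsConnected (K \ switchingSurface z b)
  field_contDiffAt : ∀ x ∈ K, ContDiffAt ℝ 1 f x
  impulse_contDiffAt : ∀ x ∈ K ∩ switchingSurface z b, ContDiffAt ℝ 1 g x
  invariant : StrictlyForwardInvariant f g (switchingSurface z b) K
  field_ne_zero : ∀ x ∈ K, f x ≠ 0
  reaches : ReachesSurface f g (switchingSurface z b) K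
  transversal : ∀ x ∈ K ∩ switchingSurface z b, inner ℝ (f x) z ≠ 0

/-- A flow arc that stays in `K`. -/
structure IsFlowArcIn (f : EuclideanSpace ℝ (Fin n) → EuclideanSpace ℝ (Fin n))
    (S K : Set (EuclideanSpace ℝ (Fin n))) (u : ℝ → EuclideanSpace ℝ (Fin n)) (τ : ℝ) : Prop
    extends IsFlowArc f S u τ where
  mapsTo : ∀ t ∈ Icc 0 τ, u t ∈ K

theorem isClosed_switchingSurface (z : EuclideanSpace ℝ (Fin n)) (b : ℝ) :
    IsClosed (switchingSurface z b) :=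
  isClosed_eq (by fun_prop) continuous_const

/-- From a point of `S`, a small step along `z` leaves the side `c ≤ 0`. -/
theorem notMem_switchingSurface_of_mem_interior (hz : z ≠ 0)
    (hside : ∀ x ∈ K, inner ℝ z x - b ≤ 0) {x : EuclideanSpace ℝ (Fin n)}
    (hx : x ∈ interior K) : x ∉ switchingSurface z b := by
  intro hxS
  have hc : Continuous fun t : ℝ => x + t • z := by fun_prop
  have h1 : ∀ᶠ t : ℝ in 𝓝 0, x + t • z ∈ interior K :=
    hc.continuousAt.eventually (by simpa using isOpen_interior.mem_nhds hx)
  obtain ⟨t, ht, ht0⟩ := ((h1.filter_mono nhdsWithin_le_nhds).and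
    (self_mem_nhdsWithin : Ioi (0 : ℝ) ∈ 𝓝[>] 0)).exists
  have h2 := hside _ (interior_subset ht)
  have h3 : inner ℝ z x - b = 0 := hxS
  rw [inner_add_right, inner_smul_right, real_inner_self_eq_norm_sq] at h2
  have h4 : 0 < t * ‖z‖ ^ 2 := mul_pos ht0 (by have := norm_pos_iff.2 hz; positivity)
  linarith

namespace IsSinglePhase

/-- Invariance speaks of positive times only; time `0`, where the state may already be `g x₀`,
follows by right continuity and closedness of `K`. -/
theorem mem_of_solution (h : IsSinglePhase f g z b K) {x₀ : EuclideanSpace ℝ (Fin n)}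
    (hx₀ : x₀ ∈ K) {x : ℝ → EuclideanSpace ℝ (Fin n)}
    (hx : IsHybridSolutionFrom f g (switchingSurface z b) x₀ x) {t : ℝ} (ht : 0 ≤ t) :
    x t ∈ K \ switchingSurface z b := by
  refine ⟨?_, hx.1.notMem t ht⟩
  have hpos := (h.invariant x₀ hx₀).2 x hx
  rcases ht.eq_or_lt with rfl | ht
  · have h1 : Tendsto x (𝓝[>] 0) (𝓝 (x 0)) :=
      (hx.1.flow 0 le_rfl).continuousWithinAt.mono_left (nhdsWithin_mono _ Ioi_subset_Ici_self)
    refine h.compact.isClosed.mem_of_tendsto h1 ?_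
    filter_upwards [self_mem_nhdsWithin] with s hs using interior_subset (hpos s hs)
  · exact interior_subset (hpos t ht)

theorem impulse_mem (h : IsSinglePhase f g z b K) {y : EuclideanSpace ℝ (Fin n)}
    (hy : y ∈ K ∩ switchingSurface z b) : g y ∈ K \ switchingSurface z b := by
  obtain ⟨x, hx⟩ := (h.invariant y hy.1).1
  rw [← hx.2.1 hy.2]
  exact h.mem_of_solution hy.1 hx le_rfl

theorem exists_arc_of_solution (h : IsSinglePhase f g z b K) {x₀ : EuclideanSpace ℝ (Fin n)}
    (hx₀ : x₀ ∈ K) {x : ℝ → EuclideanSpace ℝ (Fin n)}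
    (hx : IsHybridSolutionFrom f g (switchingSurface z b) x₀ x) :
    ∃ u τ, IsFlowArcIn f (switchingSurface z b) K u τ ∧ u 0 = x 0 := by
  obtain ⟨u, τ, hu, heq, -⟩ := hx.1.exists_isFlowArc (isClosed_switchingSurface z b)
    (h.reaches x₀ hx₀ x hx)
  have hlt : ∀ t ∈ Ico 0 τ, u t ∈ K := fun t ht => by
    rw [heq ht]; exact (h.mem_of_solution hx₀ hx ht.1).1
  refine ⟨u, τ, ⟨hu, fun t ht => ?_⟩, heq ⟨le_rfl, hu.pos⟩⟩
  rcases ht.2.eq_or_lt with rfl | h'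
  · refine h.compact.isClosed.mem_of_tendsto (hu.tendsto_left ⟨hu.pos, le_rfl⟩) ?_
    filter_upwards [Ioo_mem_nhdsLT hu.pos] with s hs using hlt s ⟨hs.1.le, hs.2⟩
  · exact hlt t ⟨ht.1, h'⟩

theorem exists_arc (h : IsSinglePhase f g z b K) {x₀ : EuclideanSpace ℝ (Fin n)}
    (hx₀ : x₀ ∈ K \ switchingSurface z b) :
    ∃ u τ, IsFlowArcIn f (switchingSurface z b) K u τ ∧ u 0 = x₀ := by
  obtain ⟨x, hx⟩ := (h.invariant x₀ hx₀.1).1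
  obtain ⟨u, τ, hu, h0⟩ := h.exists_arc_of_solution hx₀.1 hx
  exact ⟨u, τ, hu, h0.trans (hx.2.2 hx₀.2)⟩

end IsSinglePhase

/-! ### Estimates along arcs in the phase -/

namespace IsFlowArcIn

variable {S : Set (EuclideanSpace ℝ (Fin n))} {u v : ℝ → EuclideanSpace ℝ (Fin n)} {τ σ : ℝ}

theorem norm_sub_le (hu : IsFlowArcIn f S K u τ) {B : ℝ} (hB : ∀ x ∈ K, ‖f x‖ ≤ B) {s t : ℝ}
    (hs : 0 ≤ s) (hst : s ≤ t) (ht : t ≤ τ) : ‖u t - u s‖ ≤ B * (t - s) :=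
  norm_image_sub_le_of_norm_deriv_right_le_segment
    (hu.cont.mono (Icc_subset_Icc hs ht))
    (fun r hr => hu.flow r ⟨hs.trans hr.1, hr.2.trans_le ht⟩)
    (fun r hr => hB _ (hu.mapsTo r ⟨hs.trans hr.1, hr.2.le.trans ht⟩)) t (right_mem_Icc.2 hst)

theorem dist_le (hu : IsFlowArcIn f S K u τ) (hv : IsFlowArcIn f S K v σ) {L : NNReal}
    (hL : LipschitzOnWith L f K) {t : ℝ} (ht : 0 ≤ t) (htτ : t ≤ τ) (htσ : t ≤ σ) :
    dist (u t) (v t) ≤ Real.exp (L * t) * dist (u 0) (v 0) := by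
  have := dist_le_of_trajectories_ODE_of_mem (v := fun _ => f) (s := fun _ => K) (K := L)
    (f := u) (g := v) (a := 0) (b := t) (δ := dist (u 0) (v 0)) (fun _ _ => hL)
    (hu.cont.mono (Icc_subset_Icc_right htτ))
    (fun r hr => hu.flow r ⟨hr.1, hr.2.trans_le htτ⟩)
    (fun r hr => hu.mapsTo r ⟨hr.1, hr.2.le.trans htτ⟩)
    (hv.cont.mono (Icc_subset_Icc_right htσ))
    (fun r hr => hv.flow r ⟨hr.1, hr.2.trans_le htσ⟩)
    (fun r hr => hv.mapsTo r ⟨hr.1, hr.2.le.trans htσ⟩) le_rfl t (right_mem_Icc.2 ht)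
  rwa [sub_zero, mul_comm] at this

theorem inner_growth (hu : IsFlowArcIn f S K u τ) (z : EuclideanSpace ℝ (Fin n)) {m s t : ℝ}
    (hs : 0 ≤ s) (hst : s ≤ t) (ht : t ≤ τ) (hm : ∀ r ∈ Ico s t, m ≤ inner ℝ (f (u r)) z) :
    inner ℝ z (u s) + m * (t - s) ≤ inner ℝ z (u t) := by
  refine le_of_hasDerivWithinAt_Ici_ge (φ := fun r => inner ℝ z (u r))
    (φ' := fun r => inner ℝ (f (u r)) z) hst ?_ ?_ hm
  · exact continuousOn_const.inner (𝕜 := ℝ) (hu.cont.mono (Icc_subset_Icc hs ht))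
  · intro r hr
    have h := (hasDerivWithinAt_const r (Ici r) z).inner ℝ
      (hu.flow r ⟨hs.trans hr.1, hr.2.trans_le ht⟩)
    simpa [real_inner_comm] using h

theorem end_mem (hu : IsFlowArcIn f S K u τ) : u τ ∈ K ∩ S :=
  ⟨hu.mapsTo τ (right_mem_Icc.2 hu.pos.le), hu.mem⟩

/-- Arcs cross the surface outwards. -/
theorem inner_pos (h : IsSinglePhase f g z b K)
    (hu : IsFlowArcIn f (switchingSurface z b) K u τ) : 0 < inner ℝ (f (u τ)) z := by
  refine lt_of_le_of_ne (le_of_not_gt fun hneg => ?_) (h.transversal _ hu.end_mem).symm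
  have hc : ContinuousOn (fun t => inner ℝ (f (u t)) z) (Icc 0 τ) :=
    ((continuousOn_of_contDiffAt h.field_contDiffAt).comp hu.cont hu.mapsTo).inner (𝕜 := ℝ)
      continuousOn_const
  have hev : ∀ᶠ t in 𝓝[Icc 0 τ] τ, inner ℝ (f (u t)) z < 0 :=
    (hc τ (right_mem_Icc.2 hu.pos.le)).eventually (Iio_mem_nhds hneg)
  rw [nhdsWithin_Icc_eq_nhdsLE hu.pos] at hev
  obtain ⟨c, hc, hcsub⟩ := (mem_nhdsLE_iff_exists_mem_Ico_Ioc_subset hu.pos).1 hev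
  have hm1 : c < (c + τ) / 2 := by linarith [hc.2]
  have hm2 : (c + τ) / 2 < τ := by linarith [hc.2]
  have hm0 : 0 ≤ (c + τ) / 2 := by linarith [hc.1, hu.pos]
  -- If `c` decreased just before the arrival, it would be nonnegative there; `c ≤ 0` on `K` then
  -- puts an earlier point of the arc on `S`.
  have hmono := le_of_hasDerivWithinAt_Ici_ge (φ := fun r => -inner ℝ z (u r))
    (φ' := fun r => -inner ℝ (f (u r)) z) (m := 0) hm2.le
    (continuousOn_const.inner (𝕜 := ℝ) (hu.cont.mono (Icc_subset_Icc hm0 le_rfl))).neg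
    (fun r hr => by
      have h := ((hasDerivWithinAt_const r (Ici r) z).inner ℝ
        (hu.flow r ⟨hm0.trans hr.1, hr.2⟩)).neg
      simpa [real_inner_comm] using! h)
    (fun r hr => by
      have := hcsub ⟨hm1.trans_le hr.1, hr.2.le⟩
      exact neg_nonneg.2 (le_of_lt this))
  have h1 : inner ℝ z (u τ) - b = 0 := hu.mem
  have h2 := h.side _ (hu.mapsTo ((c + τ) / 2) ⟨hm0, hm2.le⟩)
  refine hu.notMem ((c + τ) / 2) ⟨hm0, hm2⟩ ?_
  change inner ℝ z (u ((c + τ) / 2)) - b = 0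
  linarith

end IsFlowArcIn

/-- Restricted to outward points: `K ∩ S` may also contain points where `f` points inwards, but no
arc ends there. -/
theorem IsSinglePhase.exists_transversality_bound (h : IsSinglePhase f g z b K) :
    ∃ a > 0, ∀ q ∈ K ∩ switchingSurface z b, 0 < inner ℝ (f q) z → a ≤ inner ℝ (f q) z := by
  have hcS : IsCompact (K ∩ switchingSurface z b) :=
    h.compact.inter_right (isClosed_switchingSurface z b)
  have hc : ContinuousOn (fun q => |inner ℝ (f q) z|) (K ∩ switchingSurface z b) :=
    (((continuousOn_of_contDiffAt h.field_contDiffAt).mono inter_subset_left).inner (𝕜 := ℝ)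
      continuousOn_const).abs
  obtain ⟨a, ha, hle⟩ := hcS.exists_forall_le' hc (a := 0)
    (fun q hq => abs_pos.2 (h.transversal q hq))
  exact ⟨a, ha, fun q hq hpos => (hle q hq).trans_eq (abs_of_pos hpos)⟩

/-- Near an outward crossing point the remaining flight time is controlled by the distance to that
point. -/
theorem IsSinglePhase.exists_remaining_time_le (h : IsSinglePhase f g z b K) {L : NNReal}
    (hL : LipschitzOnWith L f K) {B : ℝ} (hB0 : 0 < B) (hB : ∀ x ∈ K, ‖f x‖ ≤ B) :
    ∃ η₀ > 0, ∃ C > 0, ∀ u τ, IsFlowArcIn f (switchingSurface z b) K u τ →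
      ∀ q ∈ K ∩ switchingSurface z b, 0 < inner ℝ (f q) z → ∀ η ≤ η₀, ∀ m, 0 ≤ m → m ≤ τ →
        dist (u m) q ≤ η → τ - m ≤ C * η := by
  obtain ⟨a, ha, hale⟩ := h.exists_transversality_bound
  have hz : 0 < ‖z‖ := norm_pos_iff.2 h.normal_ne_zero
  -- At distance `η` from `q`, `c` is at least `-‖z‖ * η`, and near `q` it grows at rate at least `a
  -- / 2`.
  set C := 2 * ‖z‖ / a with hC
  have hC0 : 0 < C := by positivity
  -- Within `r` of `q` the normal speed varies by at most `a / 2`.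
  set r := a / (2 * (L + 1) * ‖z‖) with hr
  have hr0 : 0 < r := by positivity
  -- With this radius the arc stays within `r` of `q` during a further time `C * η`.
  refine ⟨r / (1 + B * C), by positivity, C, hC0, ?_⟩
  intro u τ hu q hq hqpos η hη m hm hmτ hdist
  by_contra! hlt
  have hη0 : 0 ≤ η := dist_nonneg.trans hdist
  have hηr : η * (1 + B * C) ≤ r := by rwa [le_div_iff₀ (by positivity)] at hη
  have hCη : 0 ≤ C * η := by positivity
  have hgrow := hu.inner_growth z (m := a / 2) hm (t := m + C * η) (by linarith) (by linarith)
    (fun s hs => by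
      have h1 := hu.norm_sub_le hB hm hs.1 (by linarith [hs.2])
      have h2 : B * (s - m) ≤ B * (C * η) := by gcongr; linarith [hs.2]
      have h3 : dist (u s) q ≤ r := by
        have := dist_triangle (u s) (u m) q
        rw [dist_eq_norm (u s) (u m)] at this
        linarith
      have hsK := hu.mapsTo s ⟨hm.trans hs.1, by linarith [hs.2]⟩
      have h4 := hL.dist_le_mul _ hsK q hq.1
      have h5 : |inner ℝ (f (u s) - f q) z| ≤ ‖f (u s) - f q‖ * ‖z‖ := abs_real_inner_le_norm _ _
      rw [← dist_eq_norm] at h5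
      have h6 : dist (f (u s)) (f q) * ‖z‖ ≤ a / 2 := by
        calc dist (f (u s)) (f q) * ‖z‖ ≤ ((L + 1) * r) * ‖z‖ := by
              gcongr
              refine h4.trans ?_
              gcongr
              linarith
          _ = a / 2 := by rw [hr]; field_simp
      have h7 := hale q hq hqpos
      rw [inner_sub_left] at h5
      linarith [neg_abs_le (inner ℝ (f (u s)) z - inner ℝ (f q) z)])
  have hzm : b - ‖z‖ * η ≤ inner ℝ z (u m) := by
    have h1 : |inner ℝ z (u m - q)| ≤ ‖z‖ * ‖u m - q‖ := abs_real_inner_le_norm _ _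
    rw [← dist_eq_norm, inner_sub_right] at h1
    have h2 : inner ℝ z q - b = 0 := hq.2
    have h3 : ‖z‖ * dist (u m) q ≤ ‖z‖ * η := by gcongr
    linarith [neg_abs_le (inner ℝ z (u m) - inner ℝ z q)]
  have hval : a / 2 * (m + C * η - m) = ‖z‖ * η := by rw [hC]; field_simp; ring
  rw [hval] at hgrow
  have hI : m + C * η ∈ Ico 0 τ := ⟨by linarith, by linarith⟩
  refine hu.notMem _ hI ?_
  have := h.side _ (hu.mapsTo _ (Ico_subset_Icc_self hI))
  change inner ℝ z (u (m + C * η)) - b = 0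
  linarith

/-- Flights from the points of `K \ S` to the surface `S`, with uniform bounds. -/
structure FlightData (f : EuclideanSpace ℝ (Fin n) → EuclideanSpace ℝ (Fin n))
    (S K : Set (EuclideanSpace ℝ (Fin n))) where
  path : EuclideanSpace ℝ (Fin n) → ℝ → EuclideanSpace ℝ (Fin n)
  time : EuclideanSpace ℝ (Fin n) → ℝ
  lip : NNReal
  speed : ℝ
  crossConst : ℝ
  crossRadius : ℝ
  arc : ∀ x ∈ K \ S, IsFlowArcIn f S K (path x) (time x)
  start : ∀ x ∈ K \ S, path x 0 = x
  lipschitz : LipschitzOnWith lip f K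
  speed_pos : 0 < speed
  norm_le : ∀ x ∈ K, ‖f x‖ ≤ speed
  crossConst_pos : 0 < crossConst
  crossRadius_pos : 0 < crossRadius
  time_sub_le : ∀ x ∈ K \ S, ∀ y ∈ K \ S, time x ≤ time y → ∀ η ≤ crossRadius,
    dist (path x (time x)) (path y (time x)) ≤ η → time y - time x ≤ crossConst * η

theorem IsSinglePhase.nonempty_flightData (h : IsSinglePhase f g z b K) :
    Nonempty (FlightData f (switchingSurface z b) K) := by
  obtain ⟨L, hL⟩ := h.compact.exists_lipschitzOnWith_of_contDiffAt h.field_contDiffAt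
  obtain ⟨B, hB0, hB⟩ := h.compact.exists_norm_le_of_continuousOn
    (continuousOn_of_contDiffAt h.field_contDiffAt)
  obtain ⟨η₀, hη₀, C, hC, hrem⟩ := h.exists_remaining_time_le hL hB0 hB
  choose! path time harc hstart using fun x hx => h.exists_arc (x₀ := x) hx
  refine ⟨⟨path, time, L, B, C, η₀, harc, hstart, hL, hB0, hB, hC, hη₀, ?_⟩⟩
  intro x hx y hy hle η hη hdist
  exact hrem _ _ (harc y hy) _ (harc x hx).end_mem (IsFlowArcIn.inner_pos h (harc x hx)) η hη _
    (harc x hx).pos.le hle (by rwa [dist_comm])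

/-! ### Dependence of flights on their initial state -/

namespace FlightData

variable {S : Set (EuclideanSpace ℝ (Fin n))}

/-- The point where the flight from `x` meets the surface. -/
def hit (φ : FlightData f S K) (x : EuclideanSpace ℝ (Fin n)) : EuclideanSpace ℝ (Fin n) :=
  φ.path x (φ.time x)

theorem time_pos (φ : FlightData f S K) {x : EuclideanSpace ℝ (Fin n)} (hx : x ∈ K \ S) :
    0 < φ.time x := (φ.arc x hx).pos

theorem hit_mem (φ : FlightData f S K) {x : EuclideanSpace ℝ (Fin n)} (hx : x ∈ K \ S) :
    φ.hit x ∈ K ∩ S := (φ.arc x hx).end_mem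

theorem dist_path_le (φ : FlightData f S K) {x y : EuclideanSpace ℝ (Fin n)} (hx : x ∈ K \ S)
    (hy : y ∈ K \ S) {t T : ℝ} (ht : 0 ≤ t) (htx : t ≤ φ.time x) (hty : t ≤ φ.time y)
    (htT : t ≤ T) : dist (φ.path x t) (φ.path y t) ≤ Real.exp (φ.lip * T) * dist x y := by
  have h := (φ.arc x hx).dist_le (φ.arc y hy) φ.lipschitz ht htx hty
  rw [φ.start x hx, φ.start y hy] at h
  refine h.trans ?_
  gcongr

theorem dist_path_path_le (φ : FlightData f S K) {x : EuclideanSpace ℝ (Fin n)} (hx : x ∈ K \ S)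
    {s t : ℝ} (hs : 0 ≤ s) (hst : s ≤ t) (ht : t ≤ φ.time x) :
    dist (φ.path x t) (φ.path x s) ≤ φ.speed * (t - s) := by
  rw [dist_eq_norm]
  exact (φ.arc x hx).norm_sub_le φ.norm_le hs hst ht

/-- When the shorter flight arrives, Grönwall puts the longer one near the same crossing point, so
little time remains. Only the shorter time enters the exponent, hence a bound on `φ.time x` alone
suffices. -/
theorem abs_time_sub_le (φ : FlightData f S K) {x y : EuclideanSpace ℝ (Fin n)} (hx : x ∈ K \ S)
    (hy : y ∈ K \ S) {T : ℝ} (hT : φ.time x ≤ T)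
    (hd : Real.exp (φ.lip * T) * dist x y ≤ φ.crossRadius) :
    |φ.time y - φ.time x| ≤ φ.crossConst * (Real.exp (φ.lip * T) * dist x y) := by
  rcases le_total (φ.time x) (φ.time y) with hle | hle
  · rw [abs_of_nonneg (sub_nonneg.2 hle)]
    exact φ.time_sub_le x hx y hy hle _ hd
      (φ.dist_path_le hx hy (φ.time_pos hx).le le_rfl hle hT)
  · rw [abs_sub_comm, abs_of_nonneg (sub_nonneg.2 hle)]
    refine φ.time_sub_le y hy x hx hle _ hd ?_
    rw [dist_comm x y]
    exact φ.dist_path_le hy hx (φ.time_pos hy).le le_rfl hle (hle.trans hT)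

theorem dist_hit_le (φ : FlightData f S K) {x y : EuclideanSpace ℝ (Fin n)} (hx : x ∈ K \ S)
    (hy : y ∈ K \ S) {T : ℝ} (hT : φ.time x ≤ T)
    (hd : Real.exp (φ.lip * T) * dist x y ≤ φ.crossRadius) :
    dist (φ.hit x) (φ.hit y) ≤
      (1 + φ.speed * φ.crossConst) * (Real.exp (φ.lip * T) * dist x y) := by
  have ht := φ.abs_time_sub_le hx hy hT hd
  have hsp := φ.speed_pos
  rcases le_total (φ.time x) (φ.time y) with hle | hle
  · have h1 := φ.dist_path_le hx hy (φ.time_pos hx).le le_rfl hle hT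
    have h2 := φ.dist_path_path_le hy (φ.time_pos hx).le hle le_rfl
    rw [abs_of_nonneg (sub_nonneg.2 hle)] at ht
    have h3 := mul_le_mul_of_nonneg_left ht hsp.le
    have h4 := dist_triangle_right (φ.hit x) (φ.hit y) (φ.path y (φ.time x))
    simp only [hit] at *
    linarith
  · have h1 := φ.dist_path_le hx hy (φ.time_pos hy).le hle le_rfl (hle.trans hT)
    have h2 := φ.dist_path_path_le hx (φ.time_pos hy).le hle le_rfl
    rw [abs_sub_comm, abs_of_nonneg (sub_nonneg.2 hle)] at ht
    have h3 := mul_le_mul_of_nonneg_left ht hsp.le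
    have h4 := dist_triangle (φ.hit x) (φ.path x (φ.time y)) (φ.hit y)
    simp only [hit] at *
    linarith

theorem eventually_exp_mul_dist_le (φ : FlightData f S K) (x : EuclideanSpace ℝ (Fin n)) {T : ℝ}
    {r : ℝ} (hr : 0 < r) : ∀ᶠ y in 𝓝 x, Real.exp (φ.lip * T) * dist x y < r := by
  have hc : Continuous fun y => Real.exp (φ.lip * T) * dist x y := by fun_prop
  exact hc.continuousAt.eventually (Iio_mem_nhds (by simpa using hr))

theorem continuousOn_time (φ : FlightData f S K) : ContinuousOn φ.time (K \ S) := by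
  intro x hx
  rw [ContinuousWithinAt, tendsto_iff_dist_tendsto_zero]
  have hc : Continuous fun y => φ.crossConst * (Real.exp (φ.lip * φ.time x) * dist x y) := by
    fun_prop
  refine squeeze_zero' (Eventually.of_forall fun _ => dist_nonneg) ?_
    ((hc.tendsto' x 0 (by simp)).mono_left nhdsWithin_le_nhds)
  filter_upwards [self_mem_nhdsWithin, mem_nhdsWithin_of_mem_nhds
    (φ.eventually_exp_mul_dist_le x (T := φ.time x) φ.crossRadius_pos)] with y hy hd
  exact φ.abs_time_sub_le hx hy le_rfl (le_of_lt hd)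

theorem continuousOn_hit (φ : FlightData f S K) : ContinuousOn φ.hit (K \ S) := by
  intro x hx
  rw [ContinuousWithinAt, tendsto_iff_dist_tendsto_zero]
  have hc : Continuous fun y =>
      (1 + φ.speed * φ.crossConst) * (Real.exp (φ.lip * φ.time x) * dist x y) := by fun_prop
  refine squeeze_zero' (Eventually.of_forall fun _ => dist_nonneg) ?_
    ((hc.tendsto' x 0 (by simp)).mono_left nhdsWithin_le_nhds)
  filter_upwards [self_mem_nhdsWithin, mem_nhdsWithin_of_mem_nhds
    (φ.eventually_exp_mul_dist_le x (T := φ.time x) φ.crossRadius_pos)] with y hy hd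
  rw [dist_comm]
  exact φ.dist_hit_le hx hy le_rfl (le_of_lt hd)

/-- Flights are bounded below only after an impulse: `g` maps the compact `K ∩ S` into `K \ S`,
where the arrival time is continuous and positive. Elsewhere in `K \ S` they may start arbitrarily
near `S`. -/
theorem exists_time_bounds (φ : FlightData f (switchingSurface z b) K)
    (h : IsSinglePhase f g z b K) : ∃ Tmin > 0, ∃ Tmax, ∀ y ∈ K ∩ switchingSurface z b,
      Tmin ≤ φ.time (g y) ∧ φ.time (g y) ≤ Tmax := by
  have hcS : IsCompact (K ∩ switchingSurface z b) :=
    h.compact.inter_right (isClosed_switchingSurface z b)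
  have hc : ContinuousOn (fun y => φ.time (g y)) (K ∩ switchingSurface z b) :=
    φ.continuousOn_time.comp (continuousOn_of_contDiffAt h.impulse_contDiffAt)
      fun y hy => h.impulse_mem hy
  obtain ⟨Tmin, hT, hmin⟩ := hcS.exists_forall_le' hc (a := 0)
    (fun y hy => φ.time_pos (h.impulse_mem hy))
  obtain ⟨Tmax, hmax⟩ := hcS.bddAbove_image hc
  exact ⟨Tmin, hT, Tmax, fun y hy => ⟨hmin y hy, hmax (mem_image_of_mem _ hy)⟩⟩

end FlightData

end

/-! ### The return map contracts infinitesimally -/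

section

variable {n : ℕ} {f g : EuclideanSpace ℝ (Fin n) → EuclideanSpace ℝ (Fin n)}
  {z : EuclideanSpace ℝ (Fin n)} {b : ℝ} {K : Set (EuclideanSpace ℝ (Fin n))}
  {M : EuclideanSpace ℝ (Fin n) → EuclideanSpace ℝ (Fin n) →L[ℝ] EuclideanSpace ℝ (Fin n)}
  {lam : ℝ}

/-- A metric in which the hybrid system is transverse contracting, for which the surface is
orthogonal to the flow, and whose transverse part is not expanded by the impulse. -/
structure IsContractionMetric (f g : EuclideanSpace ℝ (Fin n) → EuclideanSpace ℝ (Fin n))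
    (z : EuclideanSpace ℝ (Fin n)) (b : ℝ) (K : Set (EuclideanSpace ℝ (Fin n)))
    (M : EuclideanSpace ℝ (Fin n) → EuclideanSpace ℝ (Fin n) →L[ℝ] EuclideanSpace ℝ (Fin n))
    (lam : ℝ) : Prop where
  riemannian : IsRiemannianMetricOn M K
  rate_pos : 0 < lam
  contracting : TransverseContracting f M lam K
  orthogonal : ∀ x ∈ K ∩ switchingSurface z b, ∀ δ : EuclideanSpace ℝ (Fin n),
    inner ℝ z δ = 0 → inner ℝ (f x) (M x δ) = 0
  impulse : ∀ x ∈ K ∩ switchingSurface z b, ∀ δ : EuclideanSpace ℝ (Fin n),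
    inner ℝ δ (M x (f x)) = 0 →
      inner ℝ (fderiv ℝ g x δ) (M (g x) (fderiv ℝ g x δ)) ≤ inner ℝ δ (M x δ)

/-- `S` is flat, so `q - p` is exactly tangent and no curvature error appears. -/
theorem IsContractionMetric.inner_sub_eq_zero (hm : IsContractionMetric f g z b K M lam)
    {p q : EuclideanSpace ℝ (Fin n)} (hp : p ∈ K ∩ switchingSurface z b)
    (hq : q ∈ K ∩ switchingSurface z b) : inner ℝ (q - p) (M p (f p)) = 0 := by
  have h1 : inner ℝ z q - b = 0 := hq.2
  have h2 : inner ℝ z p - b = 0 := hp.2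
  have h3 := hm.orthogonal p hp (q - p) (by rw [inner_sub_right]; linarith)
  rw [← hm.riemannian.symmetric p hp.1, real_inner_comm, h3]

/-- The impulse condition applies to `q - p` itself; only the Taylor remainder of `g` has to be
added. -/
theorem IsContractionMetric.metricSq_impulse_le (hm : IsContractionMetric f g z b K M lam)
    {p q : EuclideanSpace ℝ (Fin n)} (hp : p ∈ K ∩ switchingSurface z b)
    (hq : q ∈ K ∩ switchingSurface z b) (hgp : g p ∈ K) {β Λ ε : ℝ} (hβ : ‖M (g p)‖ ≤ β)
    (hΛ : ‖g q - g p‖ ≤ Λ * ‖q - p‖) (hε0 : 0 ≤ ε) (hε1 : ε ≤ 1)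
    (hε : ‖g q - g p - fderiv ℝ g p (q - p)‖ ≤ ε * ‖q - p‖) :
    metricSq M (g p) (g q - g p) ≤
      metricSq M p (q - p) + β * (2 * Λ + 3) * ε * ‖q - p‖ ^ 2 := by
  have hβ0 : 0 ≤ β := (norm_nonneg _).trans hβ
  set d := ‖q - p‖ with hd
  set w := fderiv ℝ g p (q - p) with hw
  set e := g q - g p - w with he
  have h1 := metricSq_add_le hβ (hm.riemannian.symmetric _ hgp) w e
  have h2 : w + e = g q - g p := by rw [he]; abel
  have h3 : metricSq M (g p) w ≤ metricSq M p (q - p) :=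
    hm.impulse p hp _ (hm.inner_sub_eq_zero hp hq)
  have h4 : ‖w‖ ≤ Λ * d + ε * d := by
    have : w = (g q - g p) - e := by rw [he]; abel
    rw [this]
    exact (norm_sub_le _ _).trans (add_le_add hΛ hε)
  have hd0 : 0 ≤ d := norm_nonneg _
  have hΛd : 0 ≤ Λ * d := (norm_nonneg _).trans hΛ
  have hεd : ε * d ≤ d := by nlinarith
  -- `2‖w‖` gives `2 * Λ * d + 2 * ε * d` and `‖e‖` another `ε * d`; with `ε ≤ 1` this makes the
  -- `3`.
  have h5 : ‖e‖ * (2 * ‖w‖ + ‖e‖) ≤ (ε * d) * (2 * Λ * d + 3 * d) := by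
    refine mul_le_mul hε (by linarith) (by positivity) (by positivity)
  have h6 := mul_le_mul_of_nonneg_left h5 hβ0
  rw [h2] at h1
  calc _ ≤ _ := h1
    _ ≤ metricSq M p (q - p) + β * ((ε * d) * (2 * Λ * d + 3 * d)) := by linarith
    _ = _ := by ring

theorem IsFlowArcIn.norm_sub_sub_smul_le {S : Set (EuclideanSpace ℝ (Fin n))}
    {u : ℝ → EuclideanSpace ℝ (Fin n)} {τ : ℝ} (hu : IsFlowArcIn f S K u τ)
    {m c : ℝ} (hm0 : 0 ≤ m) (hm : m ≤ τ) (F : EuclideanSpace ℝ (Fin n))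
    (hc : ∀ t ∈ Ico m τ, ‖f (u t) - F‖ ≤ c) : ‖u τ - u m - (τ - m) • F‖ ≤ c * (τ - m) := by
  have h := norm_image_sub_le_of_norm_deriv_right_le_segment (f := fun t => u t - (t - m) • F)
    (f' := fun t => f (u t) - F) (a := m) (b := τ) (C := c)
    ((hu.cont.mono (Icc_subset_Icc_left hm0)).sub (by fun_prop))
    (fun t ht => by
      have h1 := hu.flow t ⟨hm0.trans ht.1, ht.2⟩
      have h2 : HasDerivWithinAt (fun t : ℝ => (t - m) • F) ((1 : ℝ) • F) (Ici t) t :=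
        (((hasDerivAt_id t).sub_const m).smul_const F).hasDerivWithinAt
      rw [one_smul] at h2
      exact h1.sub h2) hc τ (right_mem_Icc.2 hm)
  simp only [sub_self, zero_smul, sub_zero] at h
  rwa [sub_right_comm] at h

/-- Projecting the end point of the second of two nearby trajectories to the surface along the flow
changes the transverse distance only to second order. -/
theorem IsContractionMetric.metricSq_hit_le (hm : IsContractionMetric f g z b K M lam)
    (h : IsSinglePhase f g z b K) (φ : FlightData f (switchingSurface z b) K)
    {a β : ℝ} (ha : 0 < a) (hlow : ∀ x ∈ K, ∀ d, a * ‖d‖ ^ 2 ≤ metricSq M x d)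
    (hβ : ∀ x ∈ K, ‖M x‖ ≤ β) {x y : EuclideanSpace ℝ (Fin n)}
    (hx : x ∈ K \ switchingSurface z b) (hy : y ∈ K \ switchingSurface z b)
    (hle : φ.time x ≤ φ.time y) {η : ℝ} (hη : η ≤ φ.crossRadius)
    (hdist : ‖φ.path y (φ.time x) - φ.hit x‖ ≤ η) :
    metricSq M (φ.hit x) (φ.hit y - φ.hit x) ≤
      transverseSq M (φ.hit x) (f (φ.hit x)) (φ.path y (φ.time x) - φ.hit x) +
        β * ((φ.lip * (φ.speed * φ.crossConst + 1) * φ.crossConst) * η ^ 2 *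
          (2 * (√(β / a) * η) +
            (φ.lip * (φ.speed * φ.crossConst + 1) * φ.crossConst) * η ^ 2)) := by
  have hη0 : 0 ≤ η := (norm_nonneg _).trans hdist
  have hP := φ.hit_mem hx
  have hQ := φ.hit_mem hy
  set P := φ.hit x with hPdef
  set Q := φ.hit y with hQdef
  set v := φ.path y (φ.time x) with hv
  set s := φ.time y - φ.time x with hs
  set F := f P with hF
  have hsym := hm.riemannian.symmetric P hP.1
  have hF0 : F ≠ 0 := h.field_ne_zero P hP.1
  have hpos := hm.riemannian.pos hP.1 hF0
  have hβ0 : 0 ≤ β := (norm_nonneg _).trans (hβ P hP.1)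
  have hsp := φ.speed_pos
  have hcc := φ.crossConst_pos
  have htime : s ≤ φ.crossConst * η := φ.time_sub_le x hx y hy hle η hη
    (by rw [dist_comm, dist_eq_norm]; exact hdist)
  have hs0 : 0 ≤ s := sub_nonneg.2 hle
  have hx0 := (φ.time_pos hx).le
  set e := Q - v - s • F with he
  have hen : ‖e‖ ≤ (φ.lip * (φ.speed * φ.crossConst + 1) * φ.crossConst) * η ^ 2 := by
    have h1 := (φ.arc y hy).norm_sub_sub_smul_le hx0 hle F
      (c := φ.lip * (φ.speed * φ.crossConst + 1) * η) (fun t ht => by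
        have h2 := φ.lipschitz.dist_le_mul _
          ((φ.arc y hy).mapsTo t ⟨hx0.trans ht.1, ht.2.le⟩) P hP.1
        have h3 := φ.dist_path_path_le hy hx0 ht.1 ht.2.le
        have h4 : φ.speed * (t - φ.time x) ≤ φ.speed * (φ.crossConst * η) := by
          gcongr; linarith [ht.2]
        have h5 := dist_triangle (φ.path y t) v P
        rw [← dist_eq_norm] at hdist
        rw [← dist_eq_norm]
        have h6 : dist (φ.path y t) P ≤ (φ.speed * φ.crossConst + 1) * η := by linarith
        calc dist (f (φ.path y t)) F ≤ _ := h2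
          _ ≤ φ.lip * ((φ.speed * φ.crossConst + 1) * η) := by gcongr
          _ = _ := by ring)
    refine h1.trans ?_
    calc _ ≤ φ.lip * (φ.speed * φ.crossConst + 1) * η * (φ.crossConst * η) := by gcongr
      _ = _ := by ring
  set c3 := (φ.lip * (φ.speed * φ.crossConst + 1) * φ.crossConst) * η ^ 2 with hc3
  set α := alongCoeff M P F (v - P) with hα
  -- By orthogonality the tangent vector `Q - P` is all transverse.
  have h1 : metricSq M P (Q - P) = transverseSq M P F (Q - P) := by
    rw [transverseSq, hm.inner_sub_eq_zero hP hQ]; simp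
  -- The multiple `s + α` removes both the drift `s • F` of the remaining flight and the component
  -- of `v - P` along `F`.
  have h2 := transverseSq_le hsym hpos (Q - P) (s + α)
  have h3 : Q - P - (s + α) • F = (v - P - α • F) + e := by
    rw [he, add_smul]; abel
  have h4 := metricSq_add_le (hβ P hP.1) hsym (v - P - α • F) e
  rw [metricSq_sub_alongCoeff hsym hpos] at h4
  have h5 : ‖v - P - α • F‖ ≤ √(β / a) * η :=
    (hm.riemannian.norm_sub_alongCoeff_le ha hP.1 (hlow P hP.1) (hβ P hP.1) hF0 _).trans
      (by gcongr)
  have hc30 : 0 ≤ c3 := (norm_nonneg _).trans hen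
  have h6 : ‖e‖ * (2 * ‖v - P - α • F‖ + ‖e‖) ≤ c3 * (2 * (√(β / a) * η) + c3) := by gcongr
  have h7 := mul_le_mul_of_nonneg_left h6 hβ0
  rw [h1]
  rw [h3] at h2
  linarith

-- Chains the jump, the decay along the flight and the projection to `S`; all errors are `o(‖q - p‖
-- ^ 2)`. The order of the flight times ensures that the second path exists during the whole first
-- flight. `κ` is fixed before `η`, so that `η` can later be chosen small against `1 - κ`.
set_option maxHeartbeats 1000000 in
theorem IsContractionMetric.exists_return_le_of_time_le (hm : IsContractionMetric f g z b K M lam)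
    (h : IsSinglePhase f g z b K) (φ : FlightData f (switchingSurface z b) K) :
    ∃ κ > 0, κ < 1 ∧ ∀ η > 0, ∃ r > 0, ∀ p ∈ K ∩ switchingSurface z b,
      ∀ q ∈ K ∩ switchingSurface z b, ‖q - p‖ < r → φ.time (g p) ≤ φ.time (g q) →
        metricSq M (φ.hit (g p)) (φ.hit (g q) - φ.hit (g p)) ≤
          κ * metricSq M p (q - p) + η * ‖q - p‖ ^ 2 := by
  have hcS : IsCompact (K ∩ switchingSurface z b) :=
    h.compact.inter_right (isClosed_switchingSurface z b)
  have hlam := hm.rate_pos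
  obtain ⟨a, ha, hlow⟩ := hm.riemannian.exists_lower_bound h.compact
  obtain ⟨β, hβ0, hβ⟩ := h.compact.exists_norm_le_of_continuousOn
    (continuousOn_of_contDiffAt hm.riemannian.contDiffAt)
  obtain ⟨Λ, hΛ⟩ := hcS.exists_lipschitzOnWith_of_contDiffAt h.impulse_contDiffAt
  obtain ⟨Tmin, hTmin, Tmax, hT⟩ := φ.exists_time_bounds h
  -- Jump and flight enlarge distances at most by the factor `E`.
  set E := Real.exp (φ.lip * Tmax) * Λ with hE
  have hE0 : 0 ≤ E := by positivity
  set c₃ := φ.lip * (φ.speed * φ.crossConst + 1) * φ.crossConst with hc3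
  have hc30 : 0 ≤ c₃ := by have := φ.speed_pos; have := φ.crossConst_pos; positivity
  -- `A₁` collects the errors of size `ε * d ^ 2` from the linearisations of `g` and `f`, `A₂` those
  -- of size `d ^ 3` from the projection to `S`; each group gets `η / 2`.
  set A₁ := β * (2 * Λ + 3) + β * √(β / a) * E ^ 2 / lam with hA1
  have hA10 : 0 ≤ A₁ := by positivity
  set A₂ := β * (c₃ * E ^ 2 * (2 * (√(β / a) * E) + c₃ * E ^ 2)) with hA2
  have hA20 : 0 ≤ A₂ := by positivity
  refine ⟨Real.exp (-(2 * lam) * Tmin), Real.exp_pos _, by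
    rw [Real.exp_lt_one_iff]; linarith [mul_pos hlam hTmin], fun η hη => ?_⟩
  set ε := min 1 (η / (2 * (A₁ + 1))) with hε
  have hε0 : 0 < ε := by positivity
  have hε1 : ε ≤ 1 := min_le_left _ _
  have hAε : A₁ * ε ≤ η / 2 := by
    calc A₁ * ε ≤ (A₁ + 1) * (η / (2 * (A₁ + 1))) := by gcongr; linarith; exact min_le_right _ _
      _ = η / 2 := by field_simp
  obtain ⟨rf, hrf, hfd⟩ := h.compact.exists_uniform_fderiv h.field_contDiffAt hε0
  obtain ⟨rg, hrg, hgd⟩ := hcS.exists_uniform_fderiv h.impulse_contDiffAt hε0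
  have hη₀ := φ.crossRadius_pos
  set r := min (min 1 (η / (2 * (A₂ + 1)))) (min rg (min (φ.crossRadius / (E + 1)) (rf / (E + 1))))
    with hr
  refine ⟨r, by positivity, ?_⟩
  intro p hp q hq hpq hle
  set d := ‖q - p‖ with hd
  have hd0 : 0 ≤ d := norm_nonneg _
  have hd1 : d ≤ 1 := hpq.le.trans ((min_le_left _ _).trans (min_le_left _ _))
  have hdη : d ≤ η / (2 * (A₂ + 1)) :=
    hpq.le.trans ((min_le_left _ _).trans (min_le_right _ _))
  have hdg : d < rg := hpq.trans_le ((min_le_right _ _).trans (min_le_left _ _))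
  have hdc : d ≤ φ.crossRadius / (E + 1) :=
    hpq.le.trans ((min_le_right _ _).trans ((min_le_right _ _).trans (min_le_left _ _)))
  have hdf : d < rf / (E + 1) :=
    hpq.trans_le ((min_le_right _ _).trans ((min_le_right _ _).trans (min_le_right _ _)))
  rw [le_div_iff₀ (by positivity)] at hdc hdη
  rw [lt_div_iff₀ (by positivity)] at hdf
  have hx := h.impulse_mem hp
  have hy := h.impulse_mem hq
  have hgΛ : ‖g q - g p‖ ≤ Λ * d := by
    rw [hd, ← dist_eq_norm, ← dist_eq_norm]; exact hΛ.dist_le_mul q hq p hp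
  have hjump := hm.metricSq_impulse_le hp hq hx.1 (hβ _ hx.1) hgΛ hε0.le hε1
    (hgd p hp q (by rwa [dist_eq_norm]))
  set x := g p with hxdef
  set y := g q with hydef
  set m := φ.time x with hmdef
  have hm0 := φ.time_pos hx
  have hclose : ∀ t ∈ Icc 0 m, ‖φ.path y t - φ.path x t‖ ≤ E * d := by
    intro t ht
    have h1 := φ.dist_path_le hx hy ht.1 ht.2 (ht.2.trans hle) (ht.2.trans (hT p hp).2)
    rw [dist_comm, dist_eq_norm, dist_comm, dist_eq_norm] at h1
    calc _ ≤ _ := h1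
      _ ≤ Real.exp (φ.lip * Tmax) * (Λ * d) := by gcongr
      _ = _ := by rw [hE]; ring
  have hflow := hm.riemannian.transverseSq_trajectories_le h.field_contDiffAt h.field_ne_zero hlam
    hm.contracting ha hlow hβ (u := φ.path x) (v := φ.path y) (m := m) (ε := ε) (D := E * d)
    hm0.le hε0.le (φ.arc x hx).cont ((φ.arc y hy).cont.mono (Icc_subset_Icc_right hle))
    (φ.arc x hx).flow (fun t ht => (φ.arc y hy).flow t ⟨ht.1, ht.2.trans_le hle⟩)
    (φ.arc x hx).mapsTo (fun t ht => hclose t (Ico_subset_Icc_self ht))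
    (fun t ht => hfd _ ((φ.arc x hx).mapsTo t (Ico_subset_Icc_self ht)) _ (by
      have := hclose t (Ico_subset_Icc_self ht)
      rw [dist_eq_norm]
      linarith))
  rw [φ.start x hx, φ.start y hy] at hflow
  have hend := hm.metricSq_hit_le h φ ha hlow hβ hx hy hle (η := E * d) (by linarith)
    (hclose m (right_mem_Icc.2 hm0.le))
  have hW0 : transverseSq M x (f x) (y - x) ≤ metricSq M x (y - x) := by
    have := transverseSq_le (hm.riemannian.symmetric x hx.1)
      (hm.riemannian.pos hx.1 (h.field_ne_zero x hx.1)) (y - x) 0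
    rwa [zero_smul, sub_zero] at this
  have hexp1 : Real.exp (-(2 * lam) * m) ≤ Real.exp (-(2 * lam) * Tmin) := by
    apply Real.exp_le_exp.2
    linarith [mul_le_mul_of_nonneg_left (hT p hp).1 hlam.le]
  have hexp2 : Real.exp (-(2 * lam) * Tmin) ≤ 1 := by
    rw [Real.exp_le_one_iff]; linarith [mul_pos hlam hTmin]
  have hexp0 := Real.exp_pos (-(2 * lam) * m)
  set κ := Real.exp (-(2 * lam) * Tmin) with hκ
  have hN0 : 0 ≤ metricSq M p (q - p) := (by positivity : 0 ≤ a * ‖q - p‖ ^ 2).trans (hlow p hp.1 _)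
  set N := metricSq M p (q - p) with hN
  have herr0 : 0 ≤ β * (2 * Λ + 3) * ε * d ^ 2 := by positivity
  have h1 : Real.exp (-(2 * lam) * m) * transverseSq M x (f x) (y - x) ≤
      κ * N + β * (2 * Λ + 3) * ε * d ^ 2 := by
    calc _ ≤ Real.exp (-(2 * lam) * m) * (N + β * (2 * Λ + 3) * ε * d ^ 2) := by
          gcongr; linarith
      _ ≤ κ * (N + β * (2 * Λ + 3) * ε * d ^ 2) := by gcongr
      _ ≤ _ := by linarith [mul_le_mul_of_nonneg_right hexp2 herr0]
  have h2 : β * (c₃ * (E * d) ^ 2 * (2 * (√(β / a) * (E * d)) + c₃ * (E * d) ^ 2)) ≤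
      A₂ * d * d ^ 2 := by
    have h3 : c₃ * E ^ 2 * d ^ 2 ≤ c₃ * E ^ 2 * d := by
      have : d ^ 2 ≤ d := by rw [sq]; exact mul_le_of_le_one_left hd0 hd1
      gcongr
    calc _ = β * (c₃ * E ^ 2 * (2 * (√(β / a) * E) * d + c₃ * E ^ 2 * d ^ 2)) * d ^ 2 := by ring
      _ ≤ β * (c₃ * E ^ 2 * (2 * (√(β / a) * E) * d + c₃ * E ^ 2 * d)) * d ^ 2 := by gcongr
      _ = _ := by rw [hA2]; ring
  have h3 : β * √(β / a) * ε * (E * d) ^ 2 / lam + β * (2 * Λ + 3) * ε * d ^ 2 =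
      A₁ * ε * d ^ 2 := by rw [hA1]; ring
  have h4 : A₂ * d ≤ η / 2 := by linarith
  have h5 : A₁ * ε * d ^ 2 ≤ η / 2 * d ^ 2 := by gcongr
  have h6 : A₂ * d * d ^ 2 ≤ η / 2 * d ^ 2 := by gcongr
  have hend' : metricSq M (φ.hit x) (φ.hit y - φ.hit x) ≤
      transverseSq M (φ.path x m) (f (φ.path x m)) (φ.path y m - φ.path x m) +
      β * (c₃ * (E * d) ^ 2 * (2 * (√(β / a) * (E * d)) + c₃ * (E * d) ^ 2)) := hend
  linarith

end

/-! ### Fixed points of local contractions -/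

section

variable {X Y : Type*} [MetricSpace X] [TopologicalSpace Y] {A : Set X} {P : X → X}
  {G : X → X → ℝ} {a b κ r : ℝ}

/-- The gauge decreases and dominates the distance, so a start with `b * dist x y < a * r` keeps all
iterates within the radius `r` where the contraction applies. -/
theorem gauge_iterate_le (hP : MapsTo P A A) (ha : 0 < a)
    (hlow : ∀ x ∈ A, ∀ y ∈ A, a * dist x y ≤ G x y) (hupp : ∀ x ∈ A, ∀ y ∈ A, G x y ≤ b * dist x y)
    (hκ : 0 ≤ κ) (hκ1 : κ < 1)
    (hG : ∀ x ∈ A, ∀ y ∈ A, dist x y < r → G (P x) (P y) ≤ κ * G x y) {x y : X} (hx : x ∈ A)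
    (hy : y ∈ A) (hxy : b * dist x y < a * r) (k : ℕ) :
    G (P^[k] x) (P^[k] y) ≤ κ ^ k * G x y := by
  have hG0 : 0 ≤ G x y := (mul_nonneg ha.le dist_nonneg).trans (hlow x hx y hy)
  induction k with
  | zero => simp
  | succ k ih =>
    have hxk := hP.iterate k hx
    have hyk := hP.iterate k hy
    have h1 : κ ^ k * G x y ≤ G x y := mul_le_of_le_one_left hG0 (pow_le_one₀ hκ hκ1.le)
    have h2 := hlow _ hxk _ hyk
    have h3 := hupp x hx y hy
    have h4 : dist (P^[k] x) (P^[k] y) < r := lt_of_mul_lt_mul_left (by linarith) ha.le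
    rw [Function.iterate_succ_apply', Function.iterate_succ_apply', pow_succ']
    calc _ ≤ κ * G (P^[k] x) (P^[k] y) := hG _ hxk _ hyk h4
      _ ≤ κ * (κ ^ k * G x y) := by gcongr
      _ = _ := by ring

/-- A map that contracts nearby points, measured by a gauge comparable to the distance, has a fixed
point that attracts the points of an invariant connected family. -/
theorem exists_fixedPoint_of_locally_contracting (hA : IsComplete A) (hP : MapsTo P A A)
    (ha : 0 < a) (hb : 0 < b) (hr : 0 < r)
    (hlow : ∀ x ∈ A, ∀ y ∈ A, a * dist x y ≤ G x y) (hupp : ∀ x ∈ A, ∀ y ∈ A, G x y ≤ b * dist x y)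
    (hκ : 0 ≤ κ) (hκ1 : κ < 1)
    (hG : ∀ x ∈ A, ∀ y ∈ A, dist x y < r → G (P x) (P y) ≤ κ * G x y)
    {C : Set Y} (hC : IsConnected C) {h : Y → X} (hh : ContinuousOn h C) (hmaps : MapsTo h C A)
    (hinv : ∀ c ∈ C, ∃ c' ∈ C, h c' = P (h c)) :
    ∃ p ∈ A, P p = p ∧ ∀ c ∈ C, Tendsto (fun k => P^[k] (h c)) atTop (𝓝 p) := by
  have hdist : ∀ x ∈ A, ∀ y ∈ A, b * dist x y < a * r → ∀ k,
      dist (P^[k] x) (P^[k] y) ≤ G x y / a * κ ^ k := by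
    intro x hx y hy hxy k
    have h1 := gauge_iterate_le hP ha hlow hupp hκ hκ1 hG hx hy hxy k
    have h2 := hlow _ (hP.iterate k hx) _ (hP.iterate k hy)
    rw [div_mul_eq_mul_div, le_div_iff₀ ha]
    linarith
  have hrel : ∀ c ∈ C, ∀ c' ∈ C, ∃ B : ℝ, ∀ k,
      dist (P^[k] (h c)) (P^[k] (h c')) ≤ B * κ ^ k := by
    intro c hc c' hc'
    -- Merging at rate `κ ^ k` is an equivalence relation that holds locally, hence on all of the
    -- connected set.
    refine hC.isPreconnected.induction₂
      (fun c c' => ∃ B : ℝ, ∀ k, dist (P^[k] (h c)) (P^[k] (h c')) ≤ B * κ ^ k) ?_ ?_ ?_ hc hc'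
    · intro c hc
      have h1 : ∀ᶠ c' in 𝓝[C] c, dist (h c') (h c) < a * r / b :=
        (hh c hc).eventually (Metric.ball_mem_nhds _ (by positivity))
      filter_upwards [h1, self_mem_nhdsWithin] with c' hc' hc'C
      rw [dist_comm, lt_div_iff₀ hb, mul_comm] at hc'
      exact ⟨_, hdist _ (hmaps hc) _ (hmaps hc'C) hc'⟩
    · rintro c₁ c₂ c₃ - - - ⟨B, hB⟩ ⟨B', hB'⟩
      refine ⟨B + B', fun k => (dist_triangle _ _ _).trans ((add_le_add (hB k) (hB' k)).trans_eq ?_)⟩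
      ring
    · rintro c₁ c₂ - - ⟨B, hB⟩
      exact ⟨B, fun k => by rw [dist_comm]; exact hB k⟩
  obtain ⟨c, hc⟩ := hC.nonempty
  -- Comparing an orbit with its own shift makes it a Cauchy sequence.
  obtain ⟨c', hc', hcc'⟩ := hinv c hc
  obtain ⟨B, hB⟩ := hrel c hc c' hc'
  have hcauchy : CauchySeq fun k => P^[k] (h c) := by
    refine cauchySeq_of_le_geometric κ B hκ1 fun k => ?_
    have := hB k
    rwa [hcc', ← Function.iterate_succ_apply] at this
  obtain ⟨p, hp, hlim⟩ := cauchySeq_tendsto_of_isComplete hA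
    (fun k => hP.iterate k (hmaps hc)) hcauchy
  -- Continuity of `P` is not assumed; at `p` it follows from the local contraction.
  have hPlim : Tendsto (fun k => P (P^[k] (h c))) atTop (𝓝 (P p)) := by
    rw [tendsto_iff_dist_tendsto_zero] at hlim ⊢
    have h1 : Tendsto (fun k => κ * b / a * dist (P^[k] (h c)) p) atTop (𝓝 0) := by
      simpa using hlim.const_mul (κ * b / a)
    refine squeeze_zero' (Eventually.of_forall fun _ => dist_nonneg) ?_ h1
    filter_upwards [hlim.eventually (Iio_mem_nhds hr)] with k hk
    have hk' := hP.iterate k (hmaps hc)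
    have h2 := hG _ hk' p hp hk
    have h3 := hlow _ (hP hk') _ (hP hp)
    have h4 := mul_le_mul_of_nonneg_left (hupp _ hk' p hp) hκ
    rw [div_mul_eq_mul_div, le_div_iff₀ ha]
    linarith
  have hfix : P p = p := by
    refine tendsto_nhds_unique hPlim ?_
    have := (tendsto_add_atTop_iff_nat 1).2 hlim
    simpa only [Function.iterate_succ_apply'] using this
  refine ⟨p, hp, hfix, fun c₁ hc₁ => ?_⟩
  obtain ⟨B₁, hB₁⟩ := hrel c₁ hc₁ c hc
  have h1 : Tendsto (fun k => dist (P^[k] (h c₁)) (P^[k] (h c))) atTop (𝓝 0) :=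
    squeeze_zero (fun _ => dist_nonneg) hB₁
      (by simpa using (tendsto_pow_atTop_nhds_zero_of_lt_one hκ hκ1).const_mul B₁)
  exact (tendsto_iff_of_dist h1).2 hlim

end

/-! ### The fixed point of the return map -/

section

variable {n : ℕ} {f g : EuclideanSpace ℝ (Fin n) → EuclideanSpace ℝ (Fin n)}
  {z : EuclideanSpace ℝ (Fin n)} {b : ℝ} {K : Set (EuclideanSpace ℝ (Fin n))}
  {M : EuclideanSpace ℝ (Fin n) → EuclideanSpace ℝ (Fin n) →L[ℝ] EuclideanSpace ℝ (Fin n)}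
  {lam : ℝ}

theorem FlightData.continuousOn_hit_impulse (φ : FlightData f (switchingSurface z b) K)
    (h : IsSinglePhase f g z b K) :
    ContinuousOn (fun y => φ.hit (g y)) (K ∩ switchingSurface z b) :=
  φ.continuousOn_hit.comp (continuousOn_of_contDiffAt h.impulse_contDiffAt)
    fun _ hy => h.impulse_mem hy

/-- If the flight from `g q` is the shorter one, the roles are exchanged; moving the base point of
the metric before and after the return costs a factor `1 + θ` each time. -/
theorem IsContractionMetric.exists_return_le (hm : IsContractionMetric f g z b K M lam)
    (h : IsSinglePhase f g z b K) (φ : FlightData f (switchingSurface z b) K) :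
    ∃ κ > 0, κ < 1 ∧ ∃ r > 0, ∀ p ∈ K ∩ switchingSurface z b,
      ∀ q ∈ K ∩ switchingSurface z b, dist p q < r →
        metricSq M (φ.hit (g p)) (φ.hit (g q) - φ.hit (g p)) ≤ κ * metricSq M p (q - p) := by
  have hcS : IsCompact (K ∩ switchingSurface z b) :=
    h.compact.inter_right (isClosed_switchingSurface z b)
  obtain ⟨κ, hκ, hκ1, hret⟩ := hm.exists_return_le_of_time_le h φ
  obtain ⟨a, ha, hlow⟩ := hm.riemannian.exists_lower_bound h.compact
  -- Then `κ = 1 - 8 * θ`, so `κ + 7 * θ = 1 - θ < 1` still dominates `(1 + θ) ^ 2 * (κ + θ)`.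
  set θ := (1 - κ) / 8 with hθ
  have hθ0 : 0 < θ := by linarith
  have hη : 0 < θ * a := by positivity
  obtain ⟨r₁, hr₁, h₁⟩ := hret (θ * a) hη
  obtain ⟨r₂, hr₂, h₂⟩ := hm.riemannian.exists_metricSq_le_add h.compact hη
  obtain ⟨r₃, hr₃, h₃⟩ := Metric.uniformContinuousOn_iff.1
    (hcS.uniformContinuousOn_of_continuous (φ.continuousOn_hit_impulse h)) r₂ hr₂
  have habs : ∀ x ∈ K, ∀ d, θ * a * ‖d‖ ^ 2 ≤ θ * metricSq M x d := fun x hx d => by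
    rw [mul_assoc]; exact mul_le_mul_of_nonneg_left (hlow x hx d) hθ0.le
  have hnear : ∀ x ∈ K, ∀ y ∈ K, dist x y < r₂ → ∀ d,
      metricSq M x d ≤ (1 + θ) * metricSq M y d := fun x hx y hy hxy d => by
    linarith [h₂ x hx y hy hxy d, habs y hy d]
  have hstep : ∀ p ∈ K ∩ switchingSurface z b, ∀ q ∈ K ∩ switchingSurface z b, dist p q < r₁ →
      φ.time (g p) ≤ φ.time (g q) →
        metricSq M (φ.hit (g p)) (φ.hit (g q) - φ.hit (g p)) ≤
          (κ + θ) * metricSq M p (q - p) := fun p hp q hq hpq hle => by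
    rw [dist_comm, dist_eq_norm] at hpq
    linarith [h₁ p hp q hq hpq hle, habs p hp.1 (q - p)]
  have hN0 : ∀ x ∈ K, ∀ d, 0 ≤ metricSq M x d := fun x hx d =>
    (by positivity : 0 ≤ a * ‖d‖ ^ 2).trans (hlow x hx d)
  refine ⟨κ + 7 * θ, by positivity, by linarith, min r₁ (min r₂ r₃), by positivity, ?_⟩
  intro p hp q hq hpq
  have hpq1 := hpq.trans_le (min_le_left _ _)
  have hpq2 := hpq.trans_le ((min_le_right _ _).trans (min_le_left _ _))
  have hpq3 := hpq.trans_le ((min_le_right _ _).trans (min_le_right _ _))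
  have hN := hN0 p hp.1 (q - p)
  rcases le_total (φ.time (g p)) (φ.time (g q)) with hle | hle
  · refine (hstep p hp q hq hpq1 hle).trans ?_
    gcongr
    linarith
  · have e1 := hstep q hq p hp (by rwa [dist_comm]) hle
    rw [metricSq_sub_comm M q, metricSq_sub_comm M (φ.hit (g q))] at e1
    have e2 := hnear q hq.1 p hp.1 (by rwa [dist_comm]) (q - p)
    have e3 := hnear _ (φ.hit_mem (h.impulse_mem hp)).1 _ (φ.hit_mem (h.impulse_mem hq)).1
      (h₃ p hp q hq hpq3) (φ.hit (g q) - φ.hit (g p))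
    have hfac : (1 + θ) * ((κ + θ) * (1 + θ)) ≤ κ + 7 * θ := by
      have hκθ : κ = 1 - 8 * θ := by rw [hθ]; ring
      rw [hκθ] at hκ ⊢
      nlinarith [mul_pos hθ0 hθ0, mul_pos hθ0 hκ]
    calc _ ≤ _ := e3
      _ ≤ (1 + θ) * ((κ + θ) * ((1 + θ) * metricSq M p (q - p))) := by
          gcongr
          exact e1.trans (by gcongr)
      _ = (1 + θ) * ((κ + θ) * (1 + θ)) * metricSq M p (q - p) := by ring
      _ ≤ _ := by gcongr

/-- The gauge is the `M`-length at the first point, which need not be symmetric. The connected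
family is `hit` on `K \ S`, invariant because `g (hit x)` is again in `K \ S`. -/
theorem IsContractionMetric.exists_fixedPoint (hm : IsContractionMetric f g z b K M lam)
    (h : IsSinglePhase f g z b K) (φ : FlightData f (switchingSurface z b) K) :
    ∃ p ∈ K ∩ switchingSurface z b, φ.hit (g p) = p ∧
      ∀ x ∈ K \ switchingSurface z b,
        Tendsto (fun k => (fun y => φ.hit (g y))^[k] (φ.hit x)) atTop (𝓝 p) := by
  have hcS : IsCompact (K ∩ switchingSurface z b) :=
    h.compact.inter_right (isClosed_switchingSurface z b)
  obtain ⟨κ, hκ, hκ1, r, hr, hret⟩ := hm.exists_return_le h φ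
  obtain ⟨a, ha, hlow⟩ := hm.riemannian.exists_lower_bound h.compact
  obtain ⟨β, hβ0, hβ⟩ := h.compact.exists_norm_le_of_continuousOn
    (continuousOn_of_contDiffAt hm.riemannian.contDiffAt)
  refine exists_fixedPoint_of_locally_contracting (G := fun p q => √(metricSq M p (q - p)))
    (a := √a) (b := √β) (κ := √κ) (r := r) hcS.isComplete
    (fun y hy => φ.hit_mem (h.impulse_mem hy)) (Real.sqrt_pos.2 ha) (Real.sqrt_pos.2 hβ0) hr
    ?_ ?_ (Real.sqrt_nonneg _) (by rw [Real.sqrt_lt' one_pos]; simpa using hκ1) ?_ h.connected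
    φ.continuousOn_hit (fun x hx => φ.hit_mem hx)
    (fun x hx => ⟨g (φ.hit x), h.impulse_mem (φ.hit_mem hx), rfl⟩)
  · intro p hp q _
    rw [dist_comm, dist_eq_norm]
    calc √a * ‖q - p‖ = √(a * ‖q - p‖ ^ 2) := by
          rw [Real.sqrt_mul ha.le, Real.sqrt_sq (norm_nonneg _)]
      _ ≤ _ := Real.sqrt_le_sqrt (hlow p hp.1 _)
  · intro p hp q _
    rw [dist_comm, dist_eq_norm]
    calc _ ≤ √(β * ‖q - p‖ ^ 2) := Real.sqrt_le_sqrt (metricSq_le_norm_sq (hβ p hp.1) _)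
      _ = _ := by rw [Real.sqrt_mul hβ0.le, Real.sqrt_sq (norm_nonneg _)]
  · intro p hp q hq hpq
    rw [← Real.sqrt_mul hκ.le]
    exact Real.sqrt_le_sqrt (hret p hp q hq hpq)

end

/-! ### Arcs near a transversal crossing point -/

section

variable {n : ℕ} {f g : EuclideanSpace ℝ (Fin n) → EuclideanSpace ℝ (Fin n)}
  {z : EuclideanSpace ℝ (Fin n)} {b : ℝ} {K : Set (EuclideanSpace ℝ (Fin n))}

/-- For initial states that may lie outside `K`, where invariance gives nothing. Picard–Lindelöf
provides a common existence time near `p`, during which `c` increases at a definite rate and must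
vanish. -/
theorem exists_local_arc {p : EuclideanSpace ℝ (Fin n)} (hf : ContDiffAt ℝ 1 f p)
    (hp : p ∈ switchingSurface z b) (hpos : 0 < inner ℝ (f p) z)
    {W : Set (EuclideanSpace ℝ (Fin n))} (hW : W ∈ 𝓝 p) :
    ∃ ρ > 0, ∀ x₀, dist x₀ p < ρ → inner ℝ z x₀ - b < 0 →
      ∃ u σ, IsFlowArc f (switchingSurface z b) u σ ∧ u 0 = x₀ ∧ ∀ t ∈ Icc 0 σ, u t ∈ W := by
  set a := inner ℝ (f p) z / 2 with ha
  have ha0 : 0 < a := by positivity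
  set B := ‖f p‖ + 1 with hB
  have hB0 : 0 < B := by positivity
  have hfc := hf.continuousAt
  have h1 : ∀ᶠ x in 𝓝 p, a < inner ℝ (f x) z :=
    (hfc.inner (𝕜 := ℝ) continuousAt_const).eventually (Ioi_mem_nhds (by linarith))
  have h2 : ∀ᶠ x in 𝓝 p, ‖f x‖ < B := hfc.norm.eventually (Iio_mem_nhds (by linarith))
  obtain ⟨R, hR, hball⟩ := Metric.eventually_nhds_iff.1 ((h1.and h2).and hW)
  obtain ⟨r₀, hr₀, ε, hε, hPL⟩ :=
    hf.exists_forall_mem_closedBall_exists_eq_forall_mem_Ioo_hasDerivAt 0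
  set t₁ := min (ε / 2) (R / (4 * B)) with ht1
  have ht1pos : 0 < t₁ := by positivity
  have ht1ε : t₁ < ε := (min_le_left _ _).trans_lt (by linarith)
  have ht1R : B * t₁ ≤ R / 4 := by
    calc B * t₁ ≤ B * (R / (4 * B)) := by gcongr; exact min_le_right _ _
      _ = R / 4 := by field_simp
  -- The last bound makes the initial deficit of `c` smaller than the gain `a * t₁`.
  refine ⟨min r₀ (min (R / 4) (a * t₁ / (‖z‖ + 1))), by positivity, fun x₀ hx₀ hneg => ?_⟩
  have hx1 := hx₀.le.trans (min_le_left _ _)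
  have hx2 := hx₀.le.trans ((min_le_right _ _).trans (min_le_left _ _))
  have hx3 := hx₀.trans_le ((min_le_right _ _).trans (min_le_right _ _))
  obtain ⟨α, hα0, hα⟩ := hPL x₀ hx1
  have hder : ∀ t ∈ Icc 0 t₁, HasDerivAt α (f (α t)) t := fun t ht =>
    hα t ⟨by linarith [ht.1], by linarith [ht.2]⟩
  have hcont : ContinuousOn α (Icc 0 t₁) := fun t ht => (hder t ht).continuousAt.continuousWithinAt
  have hnorm : ∀ t ∈ Icc 0 t₁, ‖α t - p‖ ≤ R / 4 + B * t := by
    intro t ht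
    -- The speed bound is known only within `R` of `p`. It is needed only when the barrier `R / 4 +
    -- B * s ≤ R / 2` is touched, which is inside that ball.
    refine image_norm_le_of_norm_deriv_right_lt_deriv_boundary (f := fun t => α t - p)
      (f' := fun t => f (α t)) (B := fun t => R / 4 + B * t) (B' := fun _ => B)
      (hcont.sub continuousOn_const)
      (fun s hs => ((hder s (Ico_subset_Icc_self hs)).sub_const p).hasDerivWithinAt) ?_ ?_ ?_ ht
    · simpa [hα0, ← dist_eq_norm] using hx2
    · intro s
      simpa using ((hasDerivAt_id s).const_mul B).const_add (R / 4)
    · intro s hs heq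
      have h3 : B * s ≤ B * t₁ := by gcongr; exact hs.2.le
      exact (@hball (α s) (by rw [dist_eq_norm]; linarith)).1.2
  have hin : ∀ t ∈ Icc 0 t₁, (a < inner ℝ (f (α t)) z ∧ ‖f (α t)‖ < B) ∧ α t ∈ W := by
    intro t ht
    refine @hball (α t) ?_
    have h3 : B * t ≤ B * t₁ := by gcongr; exact ht.2
    rw [dist_eq_norm]
    linarith [hnorm t ht]
  have hgrow : ∀ s t, 0 ≤ s → s ≤ t → t ≤ t₁ →
      inner ℝ z (α s) + a * (t - s) ≤ inner ℝ z (α t) := by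
    intro s t hs hst ht
    refine le_of_hasDerivWithinAt_Ici_ge (φ := fun r => inner ℝ z (α r))
      (φ' := fun r => inner ℝ (f (α r)) z) hst
      (continuousOn_const.inner (𝕜 := ℝ) (hcont.mono (Icc_subset_Icc hs ht))) ?_
      (fun r hr => (hin r ⟨hs.trans hr.1, hr.2.le.trans ht⟩).1.1.le)
    intro r hr
    have h := (hasDerivWithinAt_const r (Ici r) z).inner ℝ
      (hder r ⟨hs.trans hr.1, hr.2.le.trans ht⟩).hasDerivWithinAt
    simpa [real_inner_comm] using h
  have hend : b < inner ℝ z (α t₁) := by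
    have h3 := hgrow 0 t₁ le_rfl ht1pos.le le_rfl
    rw [hα0, sub_zero] at h3
    have h4 : |inner ℝ z (x₀ - p)| ≤ ‖z‖ * ‖x₀ - p‖ := abs_real_inner_le_norm _ _
    rw [← dist_eq_norm, inner_sub_right] at h4
    rw [lt_div_iff₀ (by positivity)] at hx3
    have h5 : inner ℝ z p - b = 0 := hp
    have h6 := dist_nonneg (x := x₀) (y := p)
    linarith [neg_abs_le (inner ℝ z x₀ - inner ℝ z p)]
  obtain ⟨σ, hσ, hσb⟩ := intermediate_value_Icc ht1pos.le
    (continuousOn_const.inner (𝕜 := ℝ) hcont : ContinuousOn (fun t => inner ℝ z (α t)) (Icc 0 t₁))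
    (show b ∈ Icc (inner ℝ z (α 0)) (inner ℝ z (α t₁)) from ⟨by rw [hα0]; linarith, hend.le⟩)
  have hσ0 : 0 < σ := by
    refine lt_of_le_of_ne hσ.1 fun h => ?_
    rw [← h] at hσb
    simp only [hα0] at hσb
    linarith
  refine ⟨α, σ, ⟨hσ0, hcont.mono (Icc_subset_Icc_right hσ.2), fun t ht =>
    (hder t ⟨ht.1, ht.2.le.trans hσ.2⟩).hasDerivWithinAt, fun t ht hmem => ?_, ?_⟩, hα0,
    fun t ht => (hin t ⟨ht.1, ht.2.trans hσ.2⟩).2⟩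
  · have h3 := hgrow t σ ht.1 ht.2.le hσ.2
    have h4 : inner ℝ z (α t) - b = 0 := hmem
    have h5 : 0 < a * (σ - t) := mul_pos ha0 (by linarith [ht.2])
    simp only at hσb
    linarith
  · exact sub_eq_zero.2 hσb

/-! ### Itineraries of hybrid solutions -/

theorem IsSinglePhase.eqOn (h : IsSinglePhase f g z b K) {x y : ℝ → EuclideanSpace ℝ (Fin n)}
    (hx : IsHybridSolution f g (switchingSurface z b) x)
    (hy : IsHybridSolution f g (switchingSurface z b) y) (hx0 : x 0 ∈ K) (h0 : x 0 = y 0) :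
    EqOn x y (Ici 0) :=
  hx.eqOn hy (isClosed_switchingSurface z b) (fun _ ht => h.field_contDiffAt _
    (h.mem_of_solution hx0 ⟨hx, isPostState_of_notMem (hx.notMem 0 le_rfl)⟩ ht).1) h0

/-- The solution from a state in `K` off the surface. -/
theorem IsSinglePhase.exists_solution (h : IsSinglePhase f g z b K)
    {x₀ : EuclideanSpace ℝ (Fin n)} (hx₀ : x₀ ∈ K \ switchingSurface z b) :
    ∃ x, IsHybridSolution f g (switchingSurface z b) x ∧ x 0 = x₀ := by
  obtain ⟨x, hx⟩ := (h.invariant x₀ hx₀.1).1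
  exact ⟨x, hx.1, hx.2.2 hx₀.2⟩

namespace FlightData

/-- A hybrid solution follows the flight from its initial state up to the impulse. -/
theorem follow (φ : FlightData f (switchingSurface z b) K) (h : IsSinglePhase f g z b K)
    {x : ℝ → EuclideanSpace ℝ (Fin n)} (hx : IsHybridSolution f g (switchingSurface z b) x)
    {w : EuclideanSpace ℝ (Fin n)} (hw : w ∈ K \ switchingSurface z b) (h0 : x 0 = w) :
    EqOn (φ.path w) x (Ico 0 (φ.time w)) ∧ x (φ.time w) = g (φ.hit w) := by
  have h1 := (φ.arc w hw).eqOn (isClosed_switchingSurface z b) (fun t ht =>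
    h.field_contDiffAt _ ((φ.arc w hw).mapsTo t (Ico_subset_Icc_self ht))) hx
    ((φ.start w hw).trans h0.symm)
  exact ⟨h1.1, h1.2.2⟩

theorem iterate_mem (φ : FlightData f (switchingSurface z b) K) (h : IsSinglePhase f g z b K)
    {w : EuclideanSpace ℝ (Fin n)} (hw : w ∈ K \ switchingSurface z b) (k : ℕ) :
    (fun v => g (φ.hit v))^[k] w ∈ K \ switchingSurface z b :=
  MapsTo.iterate (fun _ hv => h.impulse_mem (φ.hit_mem hv)) k hw

/-- The time of the `k`-th impulse after the state `w`. -/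
noncomputable def impulseTime (φ : FlightData f (switchingSurface z b) K)
    (g : EuclideanSpace ℝ (Fin n) → EuclideanSpace ℝ (Fin n)) (w : EuclideanSpace ℝ (Fin n))
    (k : ℕ) : ℝ := ∑ i ∈ Finset.range k, φ.time ((fun v => g (φ.hit v))^[i] w)

theorem impulseTime_succ (φ : FlightData f (switchingSurface z b) K)
    (w : EuclideanSpace ℝ (Fin n)) (k : ℕ) : φ.impulseTime g w (k + 1) =
      φ.impulseTime g w k + φ.time ((fun v => g (φ.hit v))^[k] w) :=
  Finset.sum_range_succ _ _

theorem monotone_impulseTime (φ : FlightData f (switchingSurface z b) K)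
    (h : IsSinglePhase f g z b K) {w : EuclideanSpace ℝ (Fin n)}
    (hw : w ∈ K \ switchingSurface z b) : Monotone (φ.impulseTime g w) :=
  monotone_nat_of_le_succ fun k => by
    rw [φ.impulseTime_succ]
    linarith [φ.time_pos (φ.iterate_mem h hw k)]

theorem tendsto_impulseTime (φ : FlightData f (switchingSurface z b) K)
    (h : IsSinglePhase f g z b K) {w : EuclideanSpace ℝ (Fin n)}
    (hw : w ∈ K \ switchingSurface z b) : Tendsto (φ.impulseTime g w) atTop atTop := by
  obtain ⟨Tmin, hTmin, Tmax, hT⟩ := φ.exists_time_bounds h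
  -- The shift by one leaves out the first flight, which follows no impulse and may be shorter than
  -- `Tmin`.
  have hle : ∀ k : ℕ, (k : ℝ) * Tmin ≤ φ.impulseTime g w (k + 1) := by
    intro k
    induction k with
    | zero =>
      rw [φ.impulseTime_succ]
      simpa [impulseTime] using (φ.time_pos hw).le
    | succ k ih =>
      rw [φ.impulseTime_succ, Function.iterate_succ_apply']
      have := (hT _ (φ.hit_mem (φ.iterate_mem h hw k))).1
      push_cast
      linarith
  refine (tendsto_add_atTop_iff_nat 1).1 (tendsto_atTop_mono hle ?_)
  exact tendsto_natCast_atTop_atTop.atTop_mul_const hTmin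

theorem apply_impulseTime (φ : FlightData f (switchingSurface z b) K)
    (h : IsSinglePhase f g z b K) {x : ℝ → EuclideanSpace ℝ (Fin n)}
    (hx : IsHybridSolution f g (switchingSurface z b) x) {w : EuclideanSpace ℝ (Fin n)}
    (hw : w ∈ K \ switchingSurface z b) (h0 : x 0 = w) (k : ℕ) :
    0 ≤ φ.impulseTime g w k ∧ x (φ.impulseTime g w k) = (fun v => g (φ.hit v))^[k] w := by
  induction k with
  | zero => simpa [impulseTime] using h0
  | succ k ih =>
    have hk := φ.iterate_mem h hw k
    have h1 := (φ.follow h (hx.shift ih.1) hk (by simpa using ih.2)).2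
    rw [φ.impulseTime_succ, Function.iterate_succ_apply']
    refine ⟨add_nonneg ih.1 (φ.time_pos hk).le, ?_⟩
    rw [add_comm]
    exact h1

theorem exists_index (φ : FlightData f (switchingSurface z b) K)
    (h : IsSinglePhase f g z b K) {w : EuclideanSpace ℝ (Fin n)}
    (hw : w ∈ K \ switchingSurface z b) {t : ℝ} {k₀ : ℕ} (ht : φ.impulseTime g w k₀ ≤ t) :
    ∃ k ≥ k₀, φ.impulseTime g w k ≤ t ∧ t < φ.impulseTime g w (k + 1) := by
  have hex : ∃ j, t < φ.impulseTime g w j :=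
    ((φ.tendsto_impulseTime h hw).eventually_gt_atTop t).exists
  classical
  have hj := Nat.find_spec hex
  have hjk : k₀ < Nat.find hex := by
    by_contra! hle
    exact absurd (φ.monotone_impulseTime h hw hle) (not_le.2 (ht.trans_lt hj))
  obtain ⟨k, hk⟩ := Nat.exists_eq_succ_of_ne_zero (Nat.ne_of_gt (Nat.zero_lt_of_lt hjk))
  rw [hk] at hj
  refine ⟨k, by omega, not_lt.1 (Nat.find_min hex (by omega)), hj⟩

end FlightData

theorem apply_add_nat_mul_of_periodic {x : ℝ → EuclideanSpace ℝ (Fin n)} {T : ℝ} (hT : 0 < T)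
    (hx : ∀ t : ℝ, 0 ≤ t → x (t + T) = x t) (m : ℕ) {t : ℝ} (ht : 0 ≤ t) :
    x (t + m * T) = x t := by
  induction m with
  | zero => simp
  | succ m ih =>
    have h1 := hx (t + m * T) (by positivity)
    rw [← ih, ← h1]
    push_cast
    ring_nf

theorem image_Ico_eq_image_Ici_of_periodic {x : ℝ → EuclideanSpace ℝ (Fin n)} {T : ℝ}
    (hT : 0 < T) (hx : ∀ t : ℝ, 0 ≤ t → x (t + T) = x t) : x '' Ico 0 T = x '' Ici 0 := by
  refine Subset.antisymm (image_mono fun t ht => ht.1) ?_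
  rintro _ ⟨t, ht, rfl⟩
  have ht0 : 0 ≤ t := ht
  have h1 : (⌊t / T⌋₊ : ℝ) * T ≤ t := by
    rw [← le_div_iff₀ hT]; exact Nat.floor_le (by positivity)
  have h2 : t < (⌊t / T⌋₊ + 1 : ℝ) * T := by
    rw [← div_lt_iff₀ hT]; exact Nat.lt_floor_add_one _
  refine ⟨t - ⌊t / T⌋₊ * T, ⟨by linarith, by linarith⟩, ?_⟩
  rw [← apply_add_nat_mul_of_periodic hT hx ⌊t / T⌋₊ (sub_nonneg.2 h1), sub_add_cancel]

end

/-! ### The limit cycle -/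

section

variable {n : ℕ} {f g : EuclideanSpace ℝ (Fin n) → EuclideanSpace ℝ (Fin n)}
  {z : EuclideanSpace ℝ (Fin n)} {b : ℝ} {K : Set (EuclideanSpace ℝ (Fin n))}

namespace FlightData

/-- The flight that starts after the impulse at `p`, without its end point. -/
def orbit (φ : FlightData f (switchingSurface z b) K)
    (g : EuclideanSpace ℝ (Fin n) → EuclideanSpace ℝ (Fin n)) (p : EuclideanSpace ℝ (Fin n)) :
    Set (EuclideanSpace ℝ (Fin n)) := φ.path (g p) '' Ico 0 (φ.time (g p))

variable {p : EuclideanSpace ℝ (Fin n)}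

theorem hit_mem_closure_orbit (φ : FlightData f (switchingSurface z b) K)
    (h : IsSinglePhase f g z b K) (hp : p ∈ K ∩ switchingSurface z b) :
    φ.hit (g p) ∈ closure (φ.orbit g p) := by
  have harc := φ.arc (g p) (h.impulse_mem hp)
  refine mem_closure_of_tendsto (harc.tendsto_left ⟨harc.pos, le_rfl⟩) ?_
  filter_upwards [Ioo_mem_nhdsLT harc.pos] with s hs using mem_image_of_mem _ ⟨hs.1.le, hs.2⟩

theorem nonempty_orbit (φ : FlightData f (switchingSurface z b) K)
    (h : IsSinglePhase f g z b K) (hp : p ∈ K ∩ switchingSurface z b) : (φ.orbit g p).Nonempty :=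
  ⟨_, mem_image_of_mem _ ⟨le_rfl, φ.time_pos (h.impulse_mem hp)⟩⟩

theorem closure_orbit_subset (φ : FlightData f (switchingSurface z b) K)
    (h : IsSinglePhase f g z b K) (hp : p ∈ K ∩ switchingSurface z b) :
    closure (φ.orbit g p) ⊆ φ.path (g p) '' Icc 0 (φ.time (g p)) :=
  closure_minimal (image_mono Ico_subset_Icc_self)
    (isCompact_Icc.image_of_continuousOn (φ.arc (g p) (h.impulse_mem hp)).cont).isClosed

/-- Flights that start near the orbit's initial state stay near the orbit. -/
theorem exists_infDist_path_lt (φ : FlightData f (switchingSurface z b) K)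
    (h : IsSinglePhase f g z b K) (hp : p ∈ K ∩ switchingSurface z b) {ε : ℝ} (hε : 0 < ε) :
    ∃ ρ > 0, ∀ w ∈ K \ switchingSurface z b, dist w (g p) < ρ → ∀ t ∈ Ico 0 (φ.time w),
      Metric.infDist (φ.path w t) (φ.orbit g p) < ε := by
  have hx := h.impulse_mem hp
  have hsp := φ.speed_pos
  have hcc := φ.crossConst_pos
  set D := 1 + φ.speed * φ.crossConst with hD
  have hD0 : 0 < D := by positivity
  have hev : ∀ᶠ w in 𝓝 (g p), Real.exp (φ.lip * φ.time (g p)) * dist (g p) w <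
      min φ.crossRadius (ε / D) :=
    φ.eventually_exp_mul_dist_le _ (lt_min φ.crossRadius_pos (by positivity))
  obtain ⟨ρ, hρ, hball⟩ := Metric.eventually_nhds_iff.1 hev
  refine ⟨ρ, hρ, fun w hw hwp t ht => ?_⟩
  have hd := hball hwp
  set d := Real.exp (φ.lip * φ.time (g p)) * dist (g p) w with hdef
  have hd0 : 0 ≤ d := by positivity
  have hdc : d ≤ φ.crossRadius := hd.le.trans (min_le_left _ _)
  have hdε : D * d < ε := by
    have := hd.trans_le (min_le_right _ _)
    rwa [lt_div_iff₀ hD0, mul_comm] at this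
  have hDd : d ≤ D * d := le_mul_of_one_le_left hd0 (by rw [hD]; linarith [mul_pos hsp hcc])
  rcases lt_or_ge t (φ.time (g p)) with hlt | hge
  · have h1 := φ.dist_path_le hx hw ht.1 hlt.le ht.2.le hlt.le
    have h2 : φ.path (g p) t ∈ φ.orbit g p := mem_image_of_mem _ ⟨ht.1, hlt⟩
    have h3 := Metric.infDist_le_dist_of_mem (x := φ.path w t) h2
    rw [dist_comm] at h3
    linarith
  -- The reference flight has ended. The excess time is short, and the comparison is with its end
  -- point, which lies only in the closure of the orbit.
  · have hle := hge.trans ht.2.le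
    have h1 := φ.dist_path_le hx hw (φ.time_pos hx).le le_rfl hle le_rfl
    have h2 := φ.dist_path_path_le hw (φ.time_pos hx).le hge ht.2.le
    have h3 := φ.time_sub_le _ hx _ hw hle d hdc h1
    have h4 : φ.speed * (t - φ.time (g p)) ≤ φ.speed * (φ.crossConst * d) := by
      gcongr; linarith [ht.2]
    have h5 : Metric.infDist (φ.hit (g p)) (φ.orbit g p) = 0 :=
      Metric.infDist_zero_of_mem_closure (φ.hit_mem_closure_orbit h hp)
    have h6 := Metric.infDist_le_infDist_add_dist (s := φ.orbit g p) (x := φ.path w t)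
      (y := φ.hit (g p))
    have h7 := dist_triangle (φ.path w t) (φ.path w (φ.time (g p))) (φ.hit (g p))
    rw [dist_comm (φ.path w (φ.time (g p)))] at h7
    have h8 : dist (φ.hit (g p)) (φ.path w (φ.time (g p))) ≤ d := h1
    have h9 : D * d = d + φ.speed * (φ.crossConst * d) := by rw [hD]; ring
    linarith

/-- If the return map converges to `p` along the itinerary of a solution, the solution converges to
the orbit that starts after the impulse at `p`. -/
theorem tendsto_infDist_orbit (φ : FlightData f (switchingSurface z b) K)
    (h : IsSinglePhase f g z b K) (hp : p ∈ K ∩ switchingSurface z b)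
    (hlim : ∀ x ∈ K \ switchingSurface z b,
      Tendsto (fun k => (fun y => φ.hit (g y))^[k] (φ.hit x)) atTop (𝓝 p))
    {x : ℝ → EuclideanSpace ℝ (Fin n)} (hx : IsHybridSolution f g (switchingSurface z b) x)
    (h0 : x 0 ∈ K) : Tendsto (fun t => Metric.infDist (x t) (φ.orbit g p)) atTop (𝓝 0) := by
  have hw : x 0 ∈ K \ switchingSurface z b := ⟨h0, hx.notMem 0 le_rfl⟩
  -- `hit` intertwines the itinerary of states after impulses with that of states before them.
  have hsemi : Function.Semiconj φ.hit (fun v => g (φ.hit v)) (fun y => φ.hit (g y)) :=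
    fun _ => rfl
  have hstates : Tendsto (fun k => (fun v => g (φ.hit v))^[k + 1] (x 0)) atTop (𝓝 (g p)) := by
    have h1 : Tendsto (fun k => g ((fun y => φ.hit (g y))^[k] (φ.hit (x 0)))) atTop (𝓝 (g p)) :=
      (h.impulse_contDiffAt p hp).continuousAt.tendsto.comp (hlim _ hw)
    refine h1.congr fun k => ?_
    rw [Function.iterate_succ_apply', ← (hsemi.iterate_right k).eq]
  rw [tendsto_add_atTop_iff_nat (f := fun k => (fun v => g (φ.hit v))^[k] (x 0)) 1] at hstates
  rw [Metric.tendsto_atTop]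
  intro ε hε
  obtain ⟨ρ, hρ, hclose⟩ := φ.exists_infDist_path_lt h hp hε
  obtain ⟨k₀, hk₀⟩ := Metric.tendsto_atTop.1 hstates ρ hρ
  refine ⟨φ.impulseTime g (x 0) k₀, fun t ht => ?_⟩
  obtain ⟨k, hk, hkt, htk⟩ := φ.exists_index h hw ht
  have hmem := φ.iterate_mem h hw k
  obtain ⟨hpos, happ⟩ := φ.apply_impulseTime h hx hw rfl k
  rw [φ.impulseTime_succ] at htk
  have hI : t - φ.impulseTime g (x 0) k ∈ Ico 0 (φ.time ((fun v => g (φ.hit v))^[k] (x 0))) :=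
    ⟨by linarith, by linarith⟩
  have h2 := (φ.follow h (hx.shift hpos) hmem (by simpa using happ)).1 hI
  simp only [sub_add_cancel] at h2
  rw [Real.dist_0_eq_abs, abs_of_nonneg Metric.infDist_nonneg, ← h2]
  exact hclose _ hmem (hk₀ k hk) _ hI

end FlightData

/-- The hybrid solution through a fixed point of the return map. -/
theorem FlightData.exists_periodic_solution {p : EuclideanSpace ℝ (Fin n)}
    (φ : FlightData f (switchingSurface z b) K) (h : IsSinglePhase f g z b K)
    (hp : p ∈ K ∩ switchingSurface z b) (hfix : φ.hit (g p) = p) :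
    ∃ x, IsHybridSolution f g (switchingSurface z b) x ∧ x 0 = g p ∧
      (∀ t : ℝ, 0 ≤ t → x (t + φ.time (g p)) = x t) ∧
      EqOn (φ.path (g p)) x (Ico 0 (φ.time (g p))) ∧ ∀ t, 0 ≤ t → x t ∈ interior K := by
  have hgp := h.impulse_mem hp
  obtain ⟨x, hx, hx0⟩ := h.exists_solution hgp
  have hT := φ.time_pos hgp
  obtain ⟨hfollow, hret⟩ := φ.follow h hx hgp hx0
  rw [hfix] at hret
  have hper : ∀ t : ℝ, 0 ≤ t → x (t + φ.time (g p)) = x t := fun t ht =>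
    (h.eqOn hx (hx.shift hT.le) (hx0 ▸ hgp.1) (by simp [hx0, hret]) ht).symm
  refine ⟨x, hx, hx0, hper, hfollow, fun t ht => ?_⟩
  -- Adding a period makes the time positive, so strict invariance also covers `t = 0`.
  rw [← hper t ht]
  exact (h.invariant (g p) hgp.1).2 x ⟨hx, by rw [hx0]; exact isPostState_of_notMem hgp.2⟩ _ (by linarith)

theorem IsSinglePhase.isLimitCycle_orbit (h : IsSinglePhase f g z b K)
    (φ : FlightData f (switchingSurface z b) K) {p : EuclideanSpace ℝ (Fin n)}
    (hp : p ∈ K ∩ switchingSurface z b) (hfix : φ.hit (g p) = p) :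
    IsLimitCycle f g (switchingSurface z b) (φ.orbit g p) := by
  obtain ⟨x, hx, hx0, hper, hfollow, hint⟩ := φ.exists_periodic_solution h hp hfix
  refine ⟨x, φ.time (g p), φ.time_pos (h.impulse_mem hp), hx, hper, ?_, hfollow.image_eq⟩
  -- A constant solution would be an equilibrium, but `f` does not vanish on `K`.
  by_contra! hconst
  have h1 : HasDerivWithinAt x 0 (Ici 0) 0 :=
    (hasDerivWithinAt_const (0 : ℝ) (Ici 0) (x 0)).congr (fun t ht => hconst t ht) rfl
  exact h.field_ne_zero _ (interior_subset (hint 0 le_rfl))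
    ((uniqueDiffWithinAt_Ici 0).eq_deriv _ (hx.flow 0 le_rfl) h1)

/-- The distance of `y 0` from the orbit recurs with the period and tends to zero, so it is zero.
The closure adds only a point of `S`, where no solution is, so `y` is a time shift of the known
cycle. -/
theorem IsSinglePhase.limitCycle_unique (h : IsSinglePhase f g z b K)
    (φ : FlightData f (switchingSurface z b) K) {p : EuclideanSpace ℝ (Fin n)}
    (hp : p ∈ K ∩ switchingSurface z b) (hfix : φ.hit (g p) = p)
    (hlim : ∀ x ∈ K \ switchingSurface z b,
      Tendsto (fun k => (fun y => φ.hit (g y))^[k] (φ.hit x)) atTop (𝓝 p))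
    {Y : Set (EuclideanSpace ℝ (Fin n))} (hY : IsLimitCycle f g (switchingSurface z b) Y)
    (hYK : Y ⊆ K) : Y = φ.orbit g p := by
  obtain ⟨x, hx, hx0, hper, hfollow, hint⟩ := φ.exists_periodic_solution h hp hfix
  obtain ⟨y, T, hT, hy, hyper, -, rfl⟩ := hY
  have hgp := h.impulse_mem hp
  have hTp := φ.time_pos hgp
  have hy0 : y 0 ∈ K := hYK (mem_image_of_mem _ ⟨le_rfl, hT⟩)
  have hzero : Metric.infDist (y 0) (φ.orbit g p) = 0 := by
    have h1 := φ.tendsto_infDist_orbit h hp hlim hy hy0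
    have h2 : Tendsto (fun m : ℕ => (0 : ℝ) + m * T) atTop atTop := by
      simpa using tendsto_natCast_atTop_atTop.atTop_mul_const hT
    refine tendsto_nhds_unique (f := fun _ : ℕ => Metric.infDist (y 0) (φ.orbit g p))
      tendsto_const_nhds ((h1.comp h2).congr fun m => ?_)
    simp only [Function.comp_apply]
    rw [apply_add_nat_mul_of_periodic hT hyper m le_rfl]
  have hmem := φ.closure_orbit_subset h hp
    ((Metric.mem_closure_iff_infDist_zero (φ.nonempty_orbit h hp)).2 hzero)
  obtain ⟨s, hs, hsy⟩ := hmem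
  have hslt : s < φ.time (g p) := by
    refine lt_of_le_of_ne hs.2 fun heq => hy.notMem 0 le_rfl ?_
    rw [← hsy, heq]
    exact (φ.arc _ hgp).mem
  rw [hfollow ⟨hs.1, hslt⟩] at hsy
  have heq : EqOn y (fun t => x (t + s)) (Ici 0) :=
    h.eqOn hy (hx.shift hs.1) hy0 (by simp [hsy])
  rw [image_Ico_eq_image_Ici_of_periodic hT hyper, FlightData.orbit, hfollow.image_eq,
    image_Ico_eq_image_Ici_of_periodic hTp hper, heq.image_eq]
  refine Subset.antisymm ?_ ?_
  · rintro _ ⟨t, ht, rfl⟩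
    exact ⟨t + s, add_nonneg (mem_Ici.1 ht) hs.1, rfl⟩
  · rintro _ ⟨t, ht, rfl⟩
    -- One period is added to undo the shift by `s` without a negative time.
    refine ⟨t + φ.time (g p) - s, ?_, ?_⟩
    · have : (0 : ℝ) ≤ t := ht
      simp only [mem_Ici]
      linarith
    · simp only [sub_add_cancel]
      exact hper t ht

theorem IsSinglePhase.orbitallyStable_orbit (h : IsSinglePhase f g z b K)
    (φ : FlightData f (switchingSurface z b) K) {p : EuclideanSpace ℝ (Fin n)}
    (hp : p ∈ K ∩ switchingSurface z b) (hfix : φ.hit (g p) = p)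
    (hlim : ∀ x ∈ K \ switchingSurface z b,
      Tendsto (fun k => (fun y => φ.hit (g y))^[k] (φ.hit x)) atTop (𝓝 p)) :
    OrbitallyStable f g (switchingSurface z b) {x | inner ℝ z x - b ≤ 0} (φ.orbit g p) := by
  obtain ⟨x, hx, hx0, hper, hfollow, hint⟩ := φ.exists_periodic_solution h hp hfix
  have hgp := h.impulse_mem hp
  have hgpint : g p ∈ interior K := hx0 ▸ hint 0 le_rfl
  have hoff : ∀ y ∈ interior K, y ∈ K \ switchingSurface z b := fun y hy =>
    ⟨interior_subset hy, notMem_switchingSurface_of_mem_interior h.normal_ne_zero h.side hy⟩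
  have hppos : 0 < inner ℝ (f p) z := by
    have := IsFlowArcIn.inner_pos h (φ.arc _ hgp)
    rwa [show φ.path (g p) (φ.time (g p)) = p from hfix] at this
  -- Since `g p` is interior to `K`, states near `p` are thrown into the interior by `g`, even if
  -- they lie outside `K`.
  have hW : {y | ContDiffAt ℝ 1 f y ∧ g y ∈ interior K} ∈ 𝓝 p :=
    ((h.field_contDiffAt p hp.1).eventually (by simp)).and
      ((h.impulse_contDiffAt p hp).continuousAt.eventually (isOpen_interior.mem_nhds hgpint))
  obtain ⟨ρ₁, hρ₁, harc⟩ := exists_local_arc (h.field_contDiffAt p hp.1) hp.2 hppos hW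
  obtain ⟨ρ₂, hρ₂, hball⟩ := Metric.mem_nhds_iff.1 hW
  have hcompact : IsCompact (closure (φ.orbit g p)) :=
    (isCompact_Icc.image_of_continuousOn (φ.arc (g p) hgp).cont).closure_of_subset
      (image_mono Ico_subset_Icc_self)
  -- The closed orbit is interior to `K` except at `p`; compactness then gives a uniform radius `r`.
  have hcover : closure (φ.orbit g p) ⊆ interior K ∪ Metric.ball p (min ρ₁ ρ₂) := by
    intro y hy
    obtain ⟨s, hs, rfl⟩ := φ.closure_orbit_subset h hp hy
    rcases hs.2.eq_or_lt with heq | hlt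
    · right
      rw [heq, show φ.path (g p) (φ.time (g p)) = p from hfix]
      exact Metric.mem_ball_self (lt_min hρ₁ hρ₂)
    · left
      rw [hfollow ⟨hs.1, hlt⟩]
      exact hint s hs.1
  obtain ⟨r, hr, hthick⟩ := hcompact.exists_thickening_subset_open
    (isOpen_interior.union Metric.isOpen_ball) hcover
  refine ⟨r, hr, fun x₀ hside hdist => ?_⟩
  have hx₀ := hthick (Metric.thickening_subset_of_subset r subset_closure
    ((Metric.mem_thickening_iff_infDist_lt (φ.nonempty_orbit h hp)).2 hdist))
  rcases hx₀ with hin | hnear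
  · obtain ⟨x, hx, hx0⟩ := h.exists_solution (hoff x₀ hin)
    have hx₀K := interior_subset hin
    refine ⟨x, ⟨hx, by rw [hx0]; exact isPostState_of_notMem (hoff x₀ hin).2⟩, fun y hy => ?_,
      φ.tendsto_infDist_orbit h hp hlim hx (hx0 ▸ hx₀K)⟩
    have hy0 := hy.2.2 (hoff x₀ hin).2
    exact h.eqOn hy.1 hx (hy0 ▸ hx₀K) (hy0.trans hx0.symm)
  · rw [Metric.mem_ball, lt_min_iff] at hnear
    by_cases hS : x₀ ∈ switchingSurface z b
    · have hg := (hball (Metric.mem_ball.2 hnear.2)).2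
      obtain ⟨x, hx, hx0⟩ := h.exists_solution (hoff _ hg)
      refine ⟨x, ⟨hx, hx0 ▸ isPostState_of_mem hS⟩, fun y hy => ?_,
        φ.tendsto_infDist_orbit h hp hlim hx (hx0 ▸ interior_subset hg)⟩
      have hy0 := hy.2.1 hS
      exact h.eqOn hy.1 hx (hy0 ▸ interior_subset hg) (hy0.trans hx0.symm)
    -- On the side `c < 0` near `p`, the solution is a local arc up to `S` followed by a solution
    -- inside `K`.
    · obtain ⟨u, σ, hu, hu0, huW⟩ := harc x₀ hnear.1 (lt_of_le_of_ne hside hS)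
      have hg := (huW σ (right_mem_Icc.2 hu.pos.le)).2
      obtain ⟨x, hx, hx0⟩ := h.exists_solution (hoff _ hg)
      refine ⟨_, ⟨hu.concat hx hx0, ?_⟩, fun y hy => ?_, ?_⟩
      · simp only [if_pos hu.pos, hu0]
        exact isPostState_of_notMem hS
      · have hy0 := hy.2.2 hS
        obtain ⟨heq, -, hyσ⟩ := hu.eqOn (isClosed_switchingSurface z b)
          (fun t ht => (huW t (Ico_subset_Icc_self ht)).1) hy.1 (hu0.trans hy0.symm)
        have heq' := h.eqOn hx (hy.1.shift hu.pos.le) (hx0 ▸ interior_subset hg)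
          (by simp [hx0, hyσ])
        intro t ht
        change y t = if t < σ then u t else x (t - σ)
        split_ifs with hlt
        · exact (heq ⟨ht, hlt⟩).symm
        · rw [heq' (show t - σ ∈ Ici 0 from sub_nonneg.2 (not_lt.1 hlt))]
          simp
      · have h1 := (φ.tendsto_infDist_orbit h hp hlim hx (hx0 ▸ interior_subset hg)).comp
          (tendsto_atTop_add_const_right atTop (-σ) tendsto_id)
        refine h1.congr' ?_
        filter_upwards [eventually_ge_atTop σ] with t ht
        simp [not_lt.2 ht, sub_eq_add_neg]

end

theorem theorem3 {n : ℕ}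
    (f g : EuclideanSpace ℝ (Fin n) → EuclideanSpace ℝ (Fin n))
    (z : EuclideanSpace ℝ (Fin n)) (b : ℝ) (K : Set (EuclideanSpace ℝ (Fin n)))
    -- the switching surface is a hyperplane
    (hz : z ≠ 0)
    -- `K` is compact and is a single continuous phase, on the side `c ≤ 0` of the surface
    (hK : IsCompact K)
    (hside : ∀ x ∈ K, inner ℝ z x - b ≤ 0)
    (hconn : IsConnected (K \ switchingSurface z b))
    -- `f` and `g` are smooth
    (hf : ∀ x ∈ K, ContDiffAt ℝ ∞ f x)
    (hg : ∀ x ∈ K ∩ switchingSurface z b, ContDiffAt ℝ ∞ g x)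
    -- standing assumptions on the dynamics in `K`
    (hinv : StrictlyForwardInvariant f g (switchingSurface z b) K)
    (hf0 : ∀ x ∈ K, f x ≠ 0)
    (hreach : ReachesSurface f g (switchingSurface z b) K)
    (htrans : ∀ x ∈ K ∩ switchingSurface z b, inner ℝ (f x) z ≠ 0)
    -- the metric
    (M : EuclideanSpace ℝ (Fin n) → EuclideanSpace ℝ (Fin n) →L[ℝ] EuclideanSpace ℝ (Fin n))
    (hM : IsRiemannianMetricOn M K)
    -- first condition: transverse contraction of the continuous part
    (lam : ℝ) (hlam : 0 < lam) (hcontr : TransverseContracting f M lam K)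
    -- second condition: orthogonality on the switching surface
    (horth : ∀ x ∈ K ∩ switchingSurface z b, ∀ δ : EuclideanSpace ℝ (Fin n),
      inner ℝ z δ = 0 → inner ℝ (f x) (M x δ) = 0)
    -- third condition: the impulse does not expand transverse displacements
    (hjump : ∀ x ∈ K ∩ switchingSurface z b, ∀ δ : EuclideanSpace ℝ (Fin n),
      inner ℝ δ (M x (f x)) = 0 →
        inner ℝ (fderiv ℝ g x δ) (M (g x) (fderiv ℝ g x δ)) ≤ inner ℝ δ (M x δ)) :
    ∃ X : Set (EuclideanSpace ℝ (Fin n)),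
      IsLimitCycle f g (switchingSurface z b) X ∧ X ⊆ K ∧
      (∀ Y : Set (EuclideanSpace ℝ (Fin n)),
        IsLimitCycle f g (switchingSurface z b) Y → Y ⊆ K → Y = X) ∧
      OrbitallyStable f g (switchingSurface z b) {x | inner ℝ z x - b ≤ 0} X := by

  have hone : (1 : WithTop ℕ∞) ≤ ∞ := by exact_mod_cast le_top
  have h : IsSinglePhase f g z b K :=
    ⟨hz, hK, hside, hconn, fun x hx => (hf x hx).of_le hone, fun x hx => (hg x hx).of_le hone,
      hinv, hf0, hreach, htrans⟩
  have hm : IsContractionMetric f g z b K M lam := ⟨hM, hlam, hcontr, horth, hjump⟩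
  obtain ⟨φ⟩ := h.nonempty_flightData
  obtain ⟨p, hp, hfix, hlim⟩ := hm.exists_fixedPoint h φ
  refine ⟨φ.orbit g p, h.isLimitCycle_orbit φ hp hfix, ?_,
    fun Y hY hYK => h.limitCycle_unique φ hp hfix hlim hY hYK,
    h.orbitallyStable_orbit φ hp hfix hlim⟩
  rintro _ ⟨t, ht, rfl⟩
  exact (φ.arc _ (h.impulse_mem hp)).mapsTo t (Ico_subset_Icc_self ht)
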